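/- Let $0<\theta<1$ be irrational and let $h:\mathbb R\to\mathbb R$ be even, smooth and exponentially decaying ($|h(\eta)|\le Ce^{-\gamma|\eta|}$ for some $C$ and some $\gamma>0$). For $b\in\mathbb R$ let $H(b)$ be the bounded self-adjoint operator on $\ell^2(\mathbb Z)\oplus\ell^2(\mathbb Z)$, whose elements are written $\psi=((\psi_{n_1})_{n_1\in\mathbb Z},(\psi_{n_2})_{n_2\in\mathbb Z})$, given by $$(H(b)\psi)_{n_1}=\psi_{n_1+1}+\psi_{n_1-1}+\sum_{n_2\in\mathbb Z}h(n_1-(1-\theta)n_2-b)\,\psi_{n_2},\qquad (H(b)\psi)_{n_2}=\psi_{n_2+1}+\psi_{n_2-1}+\sum_{n_1\in\mathbb Z}h(n_1-(1-\theta)n_2-b)\,\psi_{n_1}.$$ For real $L>0$ put $\Lambda_L^1=\mathbb Z\cap[-L,L]$, $\Lambda_L^2=\mathbb Z\cap\bigl[-\tfrac{L+b}{1-\theta},\tfrac{L-b}{1-\theta}\bigr]$, $|\Lambda_L|=|\Lambda_L^1|+|\Lambda_L^2|$. Let $1_{\Lambda_L}$ be the operator that sets to zero the entries of $\psi$ outside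 $\Lambda_L^1$ on the first chain and outside $\Lambda_L^2$ on the second, and let $H_L(b)=1_{\Lambda_L}H(b)1_{\Lambda_L}$. Let $\delta_{x_1}$, $\delta_{x_2}$ be the standard basis vectors at site $x_1$ of chain 1 and at site $x_2$ of chain 2; $\delta_{0_1},\delta_{0_2}$ are those at the two origins. For continuous $g:\mathbb R\to\mathbb C$ that is compactly supported or vanishes at infinity put $$I_{b,L}(g)=\frac1{|\Lambda_L|}\Bigl(\sum_{x_1\in\Lambda_L^1}\langle\delta_{x_1},g(H_L(b))\delta_{x_1}\rangle+\sum_{x_2\in\Lambda_L^2}\langle\delta_{x_2},g(H_L(b))\delta_{x_2}\rangle\Bigr),$$ $$I(g)=\frac{1-\theta}{1+(1-\theta)}\cdot\frac1{1-\theta}\int_{[0,1-\theta)}\langle\delta_{0_1},g(H(b_2))\delta_{0_1}\rangle\,db_2+\frac1{1+(1-\theta)}\int_{[0,1)}\langle\delta_{0_2},g(H(b_1))\delta_{0_2}\rangle\,db_1 .$$ **Theorem.** The integrals in $I(g)$ converge absolutely for all $g\in C_0(\mathbb R)$. There are Radon measures $dk$ and $dk_{b,L}$ ($b\in\mathbb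 R$, $L>0$) on $\mathbb R$ (necessarily unique) with $\int g\,dk=I(g)$ and $\int g\,dk_{b,L}=I_{b,L}(g)$ for all $g\in C_c(\mathbb R)$, and they are probability measures. Moreover, for Lebesgue-almost every $b\in\mathbb R$ the following holds. If there is a function $\varepsilon$ with $\varepsilon(L)\to0$ as $L\to\infty$ such that for every $L>0$ the operator $H_L(b)-1_{\Lambda_L}H(b)$ is trace class and $$\operatorname{tr}\bigl|H_L(b)-1_{\Lambda_L}H(b)\bigr|\le\varepsilon(L)\,|\Lambda_L| ,$$ then, as $L\to\infty$ through the reals, $I_{b,L}(g)\to I(g)$ for every $g\in C_0(\mathbb R)$, and $dk_{b,L}$ converges weakly to $dk$, that is, $\int g\,dk_{b,L}\to\int g\,dk$ for every bounded continuous $g:\mathbb R\to\mathbb C$. -/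

import Mathlib

open scoped ENNReal NNReal Topology ContDiff InnerProductSpace BoundedContinuousFunction
  ZeroAtInfty CompactlySupported
open MeasureTheory Filter

noncomputable section

namespace CoupledChain

/-- The index set of the two chains: `Sum.inl n` is the site `n` of chain `1` and
`Sum.inr n` is the site `n` of chain `2`. -/
abbrev Site : Type := ℤ ⊕ ℤ

/-- The Hilbert space `ℓ²(ℤ) ⊕ ℓ²(ℤ)` of the coupled chain, realised as `ℓ²(ℤ ⊔ ℤ)`: its elements
are the pairs `(ψ₁, ψ₂)` of square-summable sequences, `ψ₁ n = ψ (Sum.inl n)` and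
`ψ₂ n = ψ (Sum.inr n)`, and its inner product is
`∑ conj (φ₁ n) * ψ₁ n + ∑ conj (φ₂ n) * ψ₂ n`. -/
abbrev Space : Type := lp (fun _ : Site => ℂ) 2

/-- The standard basis vector `δ_x` at the site `x`. -/
def delta (x : Site) : Space := lp.single 2 x 1

section Schur

/-- Both the rows and the columns of the infinite matrix `K` are summable, uniformly. -/
def IsSchurKernel (K : Site → Site → ℂ) : Prop :=
  ∃ C : ℝ≥0, (∀ i, ∑' j, ‖K i j‖ₑ ≤ C) ∧ (∀ j, ∑' i, ‖K i j‖ₑ ≤ C)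

lemma sq_tsum_mul_le (k p : Site → ℝ≥0∞) :
    (∑' j, k j * p j) ^ 2 ≤ (∑' j, k j) * ∑' j, k j * p j ^ 2 := by
  have key : ∀ a b : ℝ≥0∞, 2 * (a * b) ≤ a ^ 2 + b ^ 2 := by
    intro a b
    rcases eq_or_ne a ⊤ with rfl | ha
    · simp
    rcases eq_or_ne b ⊤ with rfl | hb
    · simp
    lift a to ℝ≥0 using ha
    lift b to ℝ≥0 using hb
    norm_cast
    have := two_mul_le_add_sq a b
    rwa [mul_assoc] at this
  have h2 : 2 * (∑' j, k j * p j) ^ 2 ≤ 2 * ((∑' j, k j) * ∑' j, k j * p j ^ 2) := by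
    calc 2 * (∑' j, k j * p j) ^ 2
        = ∑' i, ∑' j, k i * k j * (2 * (p i * p j)) := by
          rw [sq, ← ENNReal.tsum_mul_right, ← ENNReal.tsum_mul_left]
          refine tsum_congr fun i => ?_
          rw [← ENNReal.tsum_mul_left, ← ENNReal.tsum_mul_left]
          refine tsum_congr fun j => ?_
          ring
      _ ≤ ∑' i, ∑' j, (k i * (k j * p j ^ 2) + k j * (k i * p i ^ 2)) := by
          refine ENNReal.tsum_le_tsum fun i => ENNReal.tsum_le_tsum fun j => ?_
          calc k i * k j * (2 * (p i * p j)) ≤ k i * k j * (p i ^ 2 + p j ^ 2) := by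
                gcongr; exact key _ _
            _ = _ := by ring
      _ = 2 * ((∑' j, k j) * ∑' j, k j * p j ^ 2) := by
          have e : ∀ i j, k j * (k i * p i ^ 2) = (k i * p i ^ 2) * k j := fun i j => mul_comm _ _
          simp_rw [e, ENNReal.tsum_add, ENNReal.tsum_mul_left, ENNReal.tsum_mul_right,
            ENNReal.tsum_mul_left]
          ring
  rwa [ENNReal.mul_le_mul_iff_right (by simp) (by simp)] at h2

lemma tsum_enorm_sq (ψ : Space) : ∑' i, ‖ψ i‖ₑ ^ 2 = ‖ψ‖ₑ ^ 2 := by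
  have h := lp.hasSum_norm (p := 2) (by simp) ψ
  have e : ∀ i, ‖ψ i‖ₑ ^ 2 = ENNReal.ofReal (‖ψ i‖ ^ (2 : ℝ≥0∞).toReal) := by
    intro i
    rw [← ofReal_norm, ← ENNReal.ofReal_pow (norm_nonneg _)]
    norm_num
  simp_rw [e]
  rw [← ENNReal.ofReal_tsum_of_nonneg (fun i => by positivity) h.summable, h.tsum_eq,
    ← ofReal_norm, ← ENNReal.ofReal_pow (norm_nonneg _)]
  norm_num

variable {K : Site → Site → ℂ}

lemma tsum_enorm_kernel_sq_le {C : ℝ≥0} (h1 : ∀ i, ∑' j, ‖K i j‖ₑ ≤ C)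
    (h2 : ∀ j, ∑' i, ‖K i j‖ₑ ≤ C) (ψ : Space) :
    ∑' i, (∑' j, ‖K i j‖ₑ * ‖ψ j‖ₑ) ^ 2 ≤ (C * ‖ψ‖ₑ) ^ 2 := by
  calc ∑' i, (∑' j, ‖K i j‖ₑ * ‖ψ j‖ₑ) ^ 2
      ≤ ∑' i, C * ∑' j, ‖K i j‖ₑ * ‖ψ j‖ₑ ^ 2 := by
        refine ENNReal.tsum_le_tsum fun i => (sq_tsum_mul_le _ _).trans ?_
        gcongr
        exact h1 i
    _ = C * ∑' j, (∑' i, ‖K i j‖ₑ) * ‖ψ j‖ₑ ^ 2 := by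
        rw [ENNReal.tsum_mul_left, ENNReal.tsum_comm]
        simp_rw [ENNReal.tsum_mul_right]
    _ ≤ C * ∑' j, C * ‖ψ j‖ₑ ^ 2 := by
        gcongr with j
        exact h2 j
    _ = (C * ‖ψ‖ₑ) ^ 2 := by
        rw [ENNReal.tsum_mul_left, tsum_enorm_sq]
        ring

/-- The rows of a Schur kernel can be summed against a square-summable vector. -/
lemma IsSchurKernel.summable (hK : IsSchurKernel K) (ψ : Space) (i : Site) :
    Summable fun j => K i j * ψ j := by
  obtain ⟨C, h1, h2⟩ := hK
  have h := (ENNReal.le_tsum (f := fun i => (∑' j, ‖K i j‖ₑ * ‖ψ j‖ₑ) ^ 2) i).trans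
    (tsum_enorm_kernel_sq_le h1 h2 ψ)
  have h' : (∑' j, ‖K i j‖ₑ * ‖ψ j‖ₑ) ≠ ⊤ := by
    intro hc
    rw [hc] at h
    have : (C * ‖ψ‖ₑ : ℝ≥0∞) ^ 2 < ⊤ :=
      ENNReal.pow_lt_top (ENNReal.mul_lt_top (by simp) (by simp))
    simp only [ne_eq, OfNat.ofNat_ne_zero, not_false_eq_true, ENNReal.top_pow, top_le_iff] at h
    exact this.ne h
  refine Summable.of_enorm ?_
  simpa only [enorm_mul] using h'

lemma tsum_enorm_apply_sq_le {C : ℝ≥0} (h1 : ∀ i, ∑' j, ‖K i j‖ₑ ≤ C)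
    (h2 : ∀ j, ∑' i, ‖K i j‖ₑ ≤ C) (ψ : Space) :
    ∑' i, ‖∑' j, K i j * ψ j‖ₑ ^ 2 ≤ (C * ‖ψ‖ₑ) ^ 2 := by
  refine le_trans (ENNReal.tsum_le_tsum fun i => ?_) (tsum_enorm_kernel_sq_le h1 h2 ψ)
  gcongr
  simpa only [enorm_mul] using enorm_tsum_le_tsum_enorm (f := fun j => K i j * ψ j)

/-- The bounded operator `(T ψ) i = ∑ j, K i j * ψ j` with matrix `K`. -/
def schurOp (K : Site → Site → ℂ) (hK : IsSchurKernel K) : Space →L[ℂ] Space :=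
  LinearMap.mkContinuousOfExistsBound
    { toFun := fun ψ => ⟨fun i => ∑' j, K i j * ψ j, by
        obtain ⟨C, h1, h2⟩ := hK
        have h := tsum_enorm_apply_sq_le h1 h2 ψ
        refine memℓp_gen ?_
        have hfin : ∑' i, ‖‖∑' j, K i j * ψ j‖ ^ (2 : ℝ≥0∞).toReal‖ₑ ≠ ⊤ := by
          refine ne_top_of_le_ne_top (b := (C * ‖ψ‖ₑ) ^ 2) ?_ (le_of_eq_of_le ?_ h)
          · exact ENNReal.pow_ne_top (ENNReal.mul_ne_top (by simp) (by simp))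
          · refine tsum_congr fun i => ?_
            simp
        exact Summable.of_enorm hfin⟩
      map_add' := fun φ ψ => by
        ext i
        simp only [lp.coeFn_add, Pi.add_apply, mul_add]
        exact (hK.summable φ i).tsum_add (hK.summable ψ i)
      map_smul' := fun c ψ => by
        ext i
        simp only [lp.coeFn_smul, Pi.smul_apply, smul_eq_mul, RingHom.id_apply]
        rw [← tsum_mul_left]
        exact tsum_congr fun j => by ring }
    (by
      obtain ⟨C, h1, h2⟩ := hK
      refine ⟨C, fun ψ => ?_⟩
      have h := tsum_enorm_apply_sq_le h1 h2 ψ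
      rw [← coe_nnnorm, ← coe_nnnorm, ← NNReal.coe_mul, NNReal.coe_le_coe, ← enorm_le_coe,
        ENNReal.coe_mul]
      refine (ENNReal.pow_le_pow_left_iff two_ne_zero).1 ?_
      rw [← tsum_enorm_sq]
      exact h)

lemma schurOp_apply (hK : IsSchurKernel K) (ψ : Space) (i : Site) :
    schurOp K hK ψ i = ∑' j, K i j * ψ j := rfl

/-- An operator with Hermitian matrix is self-adjoint. -/
lemma schurOp_isSelfAdjoint (hK : IsSchurKernel K) (hsymm : ∀ i j, star (K j i) = K i j) :
    IsSelfAdjoint (schurOp K hK) := by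
  have hcoord : ∀ (φ : Space) (i : Site), φ i = ⟪delta i, φ⟫_ℂ := by
    intro φ i
    simp [delta, lp.inner_single_left]
  rw [IsSelfAdjoint, ContinuousLinearMap.star_eq_adjoint]
  ext ψ i
  rw [hcoord, ContinuousLinearMap.adjoint_inner_right, lp.inner_eq_tsum, schurOp_apply]
  refine tsum_congr fun j => ?_
  rw [schurOp_apply, tsum_eq_single i]
  · rw [← hsymm i j]
    simp [delta, mul_comm]
  · intro k hk
    simp [delta, hk]

end Schur

/-- An interlayer hopping function: an even, real, smooth, exponentially decaying function. -/
structure InterlayerHopping where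
  /-- The underlying function. -/
  toFun : ℝ → ℝ
  even : ∀ η, toFun (-η) = toFun η
  smooth : ContDiff ℝ ∞ toFun
  decay : ∃ C γ : ℝ, 0 < γ ∧ ∀ η, |toFun η| ≤ C * Real.exp (-γ * |η|)

instance : CoeFun InterlayerHopping fun _ => ℝ → ℝ := ⟨InterlayerHopping.toFun⟩

lemma exists_tsum_exp_le {a γ : ℝ} (ha : 0 < a) (hγ : 0 < γ) :
    ∃ B : ℝ≥0, ∀ t : ℝ, ∑' m : ℤ, ENNReal.ofReal (Real.exp (-γ * |t - a * m|)) ≤ B := by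
  have hs : Summable fun m : ℤ => Real.exp (γ * a) * Real.exp (-(γ * a) * |(m : ℝ)|) := by
    refine Summable.mul_left _ (Summable.of_nat_of_neg ?_ ?_)
    all_goals
      have := Real.summable_exp_nat_mul_iff.2 (show -(γ * a) < 0 by nlinarith [mul_pos hγ ha])
      refine this.congr fun n => ?_
      simp [mul_comm]
  refine ⟨(∑' m : ℤ, Real.exp (γ * a) * Real.exp (-(γ * a) * |(m : ℝ)|)).toNNReal, fun t => ?_⟩
  change _ ≤ ENNReal.ofReal _
  rw [ENNReal.ofReal_tsum_of_nonneg (fun m => by positivity) hs,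
    ← (Equiv.addRight ⌊t / a⌋).tsum_eq]
  refine ENNReal.tsum_le_tsum fun m => ENNReal.ofReal_le_ofReal ?_
  rw [← Real.exp_add]
  refine Real.exp_le_exp.2 ?_
  have h1 := Int.floor_le (t / a)
  have h2 := (Int.lt_floor_add_one (t / a)).le
  rw [le_div_iff₀ ha] at h1
  rw [div_le_iff₀ ha] at h2
  have h3 : a * |(m : ℝ)| ≤ |t - a * ((m + ⌊t / a⌋ : ℤ) : ℝ)| + a := by
    push_cast
    have e : a * |(m : ℝ)| = |a * (m : ℝ)| := by rw [abs_mul, abs_of_pos ha]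
    rw [e, show a * (m : ℝ) = -(t - a * (m + ⌊t / a⌋)) + (t - a * ⌊t / a⌋) by ring]
    refine (abs_add_le _ _).trans ?_
    rw [abs_neg]
    gcongr
    rw [abs_le]
    constructor <;> linarith
  simp only [Equiv.coe_addRight]
  nlinarith [mul_le_mul_of_nonneg_left h3 hγ.le]

lemma InterlayerHopping.exists_tsum_le (h : InterlayerHopping) {a : ℝ} (ha : 0 < a) :
    ∃ B : ℝ≥0, ∀ t : ℝ, ∑' m : ℤ, ‖(h (t - a * m) : ℂ)‖ₑ ≤ B := by
  obtain ⟨C, γ, hγ, hC⟩ := h.decay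
  obtain ⟨B, hB⟩ := exists_tsum_exp_le ha hγ
  refine ⟨C.toNNReal * B, fun t => ?_⟩
  calc ∑' m : ℤ, ‖(h (t - a * m) : ℂ)‖ₑ
      ≤ ∑' m : ℤ, ENNReal.ofReal C * ENNReal.ofReal (Real.exp (-γ * |t - a * m|)) := by
        refine ENNReal.tsum_le_tsum fun m => ?_
        rw [← ENNReal.ofReal_mul' (Real.exp_pos _).le, ← ofReal_norm, Complex.norm_real]
        exact ENNReal.ofReal_le_ofReal (hC _)
    _ ≤ (C.toNNReal * B : ℝ≥0) := by
        rw [ENNReal.tsum_mul_left, ENNReal.coe_mul]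
        gcongr
        · exact le_rfl
        · exact hB t

/-- The matrix of the coupled chain Hamiltonian: nearest-neighbour hopping inside each chain, and
hopping of amplitude `h (n₁ - (1 - θ) n₂ - b)` between the site `n₁` of chain `1` and the site
`n₂` of chain `2`. -/
def kernel (θ : ℝ) (h : InterlayerHopping) (b : ℝ) : Site → Site → ℂ
  | .inl n, .inl m => if m = n + 1 ∨ m = n - 1 then 1 else 0
  | .inr n, .inr m => if m = n + 1 ∨ m = n - 1 then 1 else 0
  | .inl n₁, .inr n₂ => (h (n₁ - (1 - θ) * n₂ - b) : ℝ)
  | .inr n₂, .inl n₁ => (h (n₁ - (1 - θ) * n₂ - b) : ℝ)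

lemma kernel_symm (θ : ℝ) (h : InterlayerHopping) (b : ℝ) (i j : Site) :
    kernel θ h b j i = kernel θ h b i j := by
  rcases i with n | n <;> rcases j with m | m <;> simp only [kernel]
  all_goals
    congr 1
    exact propext ⟨fun h => by omega, fun h => by omega⟩

lemma tsum_hop (n : ℤ) (f : ℤ → ℂ) :
    ∑' m : ℤ, (if m = n + 1 ∨ m = n - 1 then 1 else 0) * f m = f (n + 1) + f (n - 1) := by
  rw [tsum_eq_sum (s := {n + 1, n - 1}) (fun m hm => by
    rw [if_neg (by simpa using hm), zero_mul]), Finset.sum_pair (by omega)]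
  simp

lemma kernel_isSchurKernel {θ : ℝ} (hθ : θ < 1) (h : InterlayerHopping) (b : ℝ) :
    IsSchurKernel (kernel θ h b) := by
  obtain ⟨B₁, hB₁⟩ := h.exists_tsum_le (a := 1 - θ) (by linarith)
  obtain ⟨B₂, hB₂⟩ := h.exists_tsum_le (a := 1) one_pos
  have hop : ∀ n : ℤ, ∑' m : ℤ, ‖(if m = n + 1 ∨ m = n - 1 then 1 else 0 : ℂ)‖ₑ ≤ 2 := by
    intro n
    rw [tsum_eq_sum (s := {n + 1, n - 1}) (fun m hm => by
      rw [if_neg (by simpa using hm), enorm_zero]), Finset.sum_pair (by omega)]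
    simp [one_add_one_eq_two]
  have row : ∀ i, ∑' j, ‖kernel θ h b i j‖ₑ ≤ (2 + (B₁ + B₂) : ℝ≥0) := by
    intro i
    rw [ENNReal.summable.tsum_sum ENNReal.summable]
    push_cast
    rcases i with n | n
    · refine add_le_add (hop n) (le_trans (le_of_eq_of_le ?_ (hB₁ (n - b))) le_self_add)
      refine tsum_congr fun m => ?_
      simp only [kernel, sub_right_comm]
    · rw [add_comm]
      refine add_le_add (hop n) (le_trans (le_of_eq_of_le ?_ (hB₂ (-(1 - θ) * n - b)))
        le_add_self)
      rw [← (Equiv.neg ℤ).tsum_eq]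
      refine tsum_congr fun m => ?_
      have e : ((-m : ℤ) : ℝ) - (1 - θ) * n - b = -(1 - θ) * n - b - 1 * m := by
        push_cast
        ring
      simp only [kernel, Equiv.neg_apply, e]
  refine ⟨_, row, fun j => ?_⟩
  simp_rw [kernel_symm θ h b j]
  exact row j

/-- The coupled chain Hamiltonian `H(b)` on `ℓ²(ℤ) ⊕ ℓ²(ℤ)`, with interlayer shift `b`, where chain
`1` has lattice constant `1` and chain `2` has lattice constant `1 - θ`. -/
def hamiltonian (θ : ℝ) (hθ : θ < 1) (h : InterlayerHopping) (b : ℝ) : Space →L[ℂ] Space :=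
  schurOp (kernel θ h b) (kernel_isSchurKernel hθ h b)

lemma hamiltonian_apply_inl (θ : ℝ) (hθ : θ < 1) (h : InterlayerHopping) (b : ℝ) (ψ : Space)
    (n₁ : ℤ) :
    hamiltonian θ hθ h b ψ (.inl n₁) = ψ (.inl (n₁ + 1)) + ψ (.inl (n₁ - 1))
      + ∑' n₂ : ℤ, (h (n₁ - (1 - θ) * n₂ - b) : ℂ) * ψ (.inr n₂) := by
  have hs := (kernel_isSchurKernel hθ h b).summable ψ (.inl n₁)
  rw [hamiltonian, schurOp_apply, Summable.tsum_sum (hs.comp_injective Sum.inl_injective)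
    (hs.comp_injective Sum.inr_injective)]
  exact congrArg (· + _) (tsum_hop n₁ fun m => ψ (.inl m))

lemma hamiltonian_apply_inr (θ : ℝ) (hθ : θ < 1) (h : InterlayerHopping) (b : ℝ) (ψ : Space)
    (n₂ : ℤ) :
    hamiltonian θ hθ h b ψ (.inr n₂) = ψ (.inr (n₂ + 1)) + ψ (.inr (n₂ - 1))
      + ∑' n₁ : ℤ, (h (n₁ - (1 - θ) * n₂ - b) : ℂ) * ψ (.inl n₁) := by
  have hs := (kernel_isSchurKernel hθ h b).summable ψ (.inr n₂)
  rw [hamiltonian, schurOp_apply, Summable.tsum_sum (hs.comp_injective Sum.inl_injective)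
    (hs.comp_injective Sum.inr_injective), add_comm]
  exact congrArg (· + _) (tsum_hop n₂ fun m => ψ (.inr m))

lemma hamiltonian_isSelfAdjoint (θ : ℝ) (hθ : θ < 1) (h : InterlayerHopping) (b : ℝ) :
    IsSelfAdjoint (hamiltonian θ hθ h b) := by
  refine schurOp_isSelfAdjoint _ fun i j => ?_
  rw [kernel_symm]
  rcases i with n | n <;> rcases j with m | m <;>
    simp only [kernel, apply_ite star, star_one, star_zero, RCLike.star_def, Complex.conj_ofReal]

/-- The truncated chains: `Λ_L¹ = ℤ ∩ [-L, L]` on chain `1` and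
`Λ_L² = ℤ ∩ [-(L + b) / (1 - θ), (L - b) / (1 - θ)]` on chain `2`. -/
def box (θ b L : ℝ) : Finset Site :=
  (Finset.Icc ⌈-L⌉ ⌊L⌋).disjSum (Finset.Icc ⌈-((L + b) / (1 - θ))⌉ ⌊(L - b) / (1 - θ)⌋)

lemma inl_mem_box (θ b L : ℝ) (n : ℤ) :
    (.inl n : Site) ∈ box θ b L ↔ (n : ℝ) ∈ Set.Icc (-L) L := by
  simp [box, Int.ceil_le, Int.le_floor]

lemma inr_mem_box (θ b L : ℝ) (n : ℤ) :
    (.inr n : Site) ∈ box θ b L ↔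
      (n : ℝ) ∈ Set.Icc (-((L + b) / (1 - θ))) ((L - b) / (1 - θ)) := by
  simp only [box, Finset.inr_mem_disjSum, Finset.mem_Icc, Int.ceil_le, Int.le_floor, Set.mem_Icc]

/-- The multiplication operator `1_S` by the indicator function of the finite set `S` of sites,
`1_S ψ = ∑ x ∈ S, ⟨δ_x, ψ⟩ δ_x`. -/
def restrict (S : Finset Site) : Space →L[ℂ] Space :=
  ∑ x ∈ S, (innerSL ℂ (delta x)).smulRight (delta x)

lemma restrict_apply (S : Finset Site) (ψ : Space) (x : Site) :
    restrict S ψ x = if x ∈ S then ψ x else 0 := by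
  simp only [restrict, delta, sum_apply, ContinuousLinearMap.smulRight_apply, innerSL_apply_apply,
    lp.inner_single_left, lp.coeFn_sum, Finset.sum_apply, lp.coeFn_smul, Pi.smul_apply,
    lp.coeFn_single, Pi.single_apply]
  simp

/-- The truncated Hamiltonian `H_L(b) = 1_{Λ_L} H(b) 1_{Λ_L}`. -/
def truncated (θ : ℝ) (hθ : θ < 1) (h : InterlayerHopping) (b L : ℝ) : Space →L[ℂ] Space :=
  restrict (box θ b L) * hamiltonian θ hθ h b * restrict (box θ b L)

section Functions

variable {H : Type*} [NormedAddCommGroup H] [InnerProductSpace ℂ H] [CompleteSpace H]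

/-- The absolute value `|A| = (A* A)^(1/2)` of a bounded operator. -/
def absOp (A : H →L[ℂ] H) : H →L[ℂ] H := CFC.abs A

/-- The function `g(A)` of a bounded self-adjoint operator `A`, for `g : ℝ → ℂ` continuous: the
continuous functional calculus of `A`, whose spectrum is real. -/
def opFun (g : ℝ → ℂ) (A : H →L[ℂ] H) : H →L[ℂ] H := cfc (fun z : ℂ => g z.re) A

end Functions

/-- `A` is trace class: `∑ x, ⟨δ_x, |A| δ_x⟩ < ∞`. -/
def IsTraceClass (A : Space →L[ℂ] Space) : Prop :=
  Summable fun x : Site => (⟪delta x, absOp A (delta x)⟫_ℂ).re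

/-- The trace norm `tr |A| = ∑ x, ⟨δ_x, |A| δ_x⟩`. -/
def traceAbs (A : Space →L[ℂ] Space) : ℝ :=
  ∑' x : Site, (⟪delta x, absOp A (delta x)⟫_ℂ).re

/-- The diagonal matrix element `⟨δ_x, g(A) δ_x⟩`. -/
def diag (g : ℝ → ℂ) (A : Space →L[ℂ] Space) (x : Site) : ℂ :=
  ⟪delta x, opFun g A (delta x)⟫_ℂ

/-- The normalized trace of `g(H_L(b))`:
`|Λ_L|⁻¹ (∑ x₁ ∈ Λ_L¹, ⟨δ_{x₁}, g(H_L(b)) δ_{x₁}⟩ + ∑ x₂ ∈ Λ_L², ⟨δ_{x₂}, g(H_L(b)) δ_{x₂}⟩)`. -/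
def normalizedTrace (θ : ℝ) (hθ : θ < 1) (h : InterlayerHopping) (b L : ℝ) (g : ℝ → ℂ) : ℂ :=
  ((box θ b L).card : ℂ)⁻¹ * ∑ x ∈ box θ b L, diag g (truncated θ hθ h b L) x

/-- The limiting functional: the observables at the origins of the two chains, averaged over the
interlayer shift in the unit cell of the other chain, with the weights `(1 - θ) / (1 + (1 - θ))`
and `1 / (1 + (1 - θ))`. -/
def limitFunctional (θ : ℝ) (hθ : θ < 1) (h : InterlayerHopping) (g : ℝ → ℂ) : ℂ :=
  ((1 - θ) / (1 + (1 - θ)) : ℝ) *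
      (((1 / (1 - θ) : ℝ) : ℂ) *
        ∫ b in Set.Ico 0 (1 - θ), diag g (hamiltonian θ hθ h b) (.inl 0)) +
    (1 / (1 + (1 - θ)) : ℝ) * ∫ b in Set.Ico (0 : ℝ) 1, diag g (hamiltonian θ hθ h b) (.inr 0)

/-- `μ` is the Radon measure on `ℝ` that corresponds to the functional `I` on compactly supported
continuous functions. -/
structure IsRadonMeasureOf (I : (ℝ → ℂ) → ℂ) (μ : Measure ℝ) : Prop where
  regular : μ.Regular
  integral_eq : ∀ g : C_c(ℝ, ℂ), ∫ x, g x ∂μ = I g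

/-- A functional determines its Radon measure. -/
lemma IsRadonMeasureOf.unique {I : (ℝ → ℂ) → ℂ} {μ ν : Measure ℝ} (hμ : IsRadonMeasureOf I μ)
    (hν : IsRadonMeasureOf I ν) : μ = ν := by
  have := hμ.regular
  have := hν.regular
  refine Measure.ext_of_integral_eq_on_compactlySupported fun f => ?_
  let F : C_c(ℝ, ℂ) :=
    ⟨⟨fun x => (f x : ℂ), by fun_prop⟩, f.hasCompactSupport.comp_left Complex.ofReal_zero⟩
  have e : ∫ x, F x ∂μ = ∫ x, F x ∂ν := by rw [hμ.integral_eq, hν.integral_eq]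
  have e' : ∫ x, ((f x : ℝ) : ℂ) ∂μ = ∫ x, ((f x : ℝ) : ℂ) ∂ν := e
  rw [integral_complex_ofReal, integral_complex_ofReal] at e'
  exact_mod_cast e'

end CoupledChain

end

noncomputable section

namespace CoupledChain

open scoped ComplexOrder

/-! The density of states exists because the local environments of the sites equidistribute.
Translating the chains changes H(b) only through b (`kernel_shift`), so the diagonal element of
g(H(b)) at site n of chain 1 is the one at the origin for the shift b - n, and as a function of the
shift it has period 1 - θ; chain 2 behaves likewise, with step 1 - θ and period 1. These functions
are continuous (`continuous_diag_hamiltonian`) and θ is irrational, so Weyl's theorem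
(`tendsto_average_of_periodic`) turns averages over the box into the two integrals; the weights are
the limiting proportions of sites.

Replacing H by H_L costs a boundary term. For a power, the sum over the box of the diagonal of H_L^n
- H^n is at most n M^n times the total hopping across the boundary (`norm_sum_pow_sub_le`).
Exponential decay bounds that hopping independently of L (`exists_boundary_le`), so the error
vanishes after division by |Λ_L|.

Powers suffice: all functionals involved are normalized, positive and see only [-M, M], where M
bounds every ‖H(b)‖ (`IsState`), so Weierstrass approximation extends convergence to all continuous
g (`IsState.tendsto_of_pow`). The Riesz measure of such a functional is a probability measure
representing it on every continuous function, bounded or not (`IsState.integral_eq`), which gives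
weak convergence. -/

/-! ### States on the continuous functions -/

/-- `I` is a normalized positive linear functional on the continuous functions, which depends only
on their restriction to `[-M, M]`. -/
structure IsState (M : ℝ) (I : (ℝ → ℂ) → ℂ) : Prop where
  map_add : ∀ f g : ℝ → ℂ, Continuous f → Continuous g → I (fun x => f x + g x) = I f + I g
  map_mul : ∀ (c : ℂ) (f : ℝ → ℂ), Continuous f → I (fun x => c * f x) = c * I f
  map_one : I (fun _ => 1) = 1
  nonneg : ∀ f : ℝ → ℝ, Continuous f → (∀ x, 0 ≤ f x) → 0 ≤ I (fun x => (f x : ℂ))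
  norm_le : ∀ (f : ℝ → ℂ) (c : ℝ), Continuous f → (∀ x ∈ Set.Icc (-M) M, ‖f x‖ ≤ c) → ‖I f‖ ≤ c

namespace IsState

variable {M : ℝ} {I : (ℝ → ℂ) → ℂ}

lemma map_sub (hI : IsState M I) {f g : ℝ → ℂ} (hf : Continuous f) (hg : Continuous g) :
    I (fun x => f x - g x) = I f - I g := by
  have h1 := hI.map_add f (fun x => -1 * g x) hf (by fun_prop)
  rw [hI.map_mul _ _ hg] at h1
  simpa [sub_eq_add_neg] using h1

lemma norm_sub_le (hI : IsState M I) {f g : ℝ → ℂ} (hf : Continuous f) (hg : Continuous g) {c : ℝ}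
    (h : ∀ x ∈ Set.Icc (-M) M, ‖f x - g x‖ ≤ c) : ‖I f - I g‖ ≤ c := by
  rw [← hI.map_sub hf hg]
  exact hI.norm_le _ _ (by fun_prop) h

lemma mono (hI : IsState M I) {f g : ℝ → ℝ} (hf : Continuous f) (hg : Continuous g)
    (h : ∀ x, f x ≤ g x) : (I fun x => (f x : ℂ)).re ≤ (I fun x => (g x : ℂ)).re := by
  have h1 := hI.nonneg (fun x => g x - f x) (by fun_prop) fun x => sub_nonneg.2 (h x)
  have h2 := hI.map_sub (f := fun x => (g x : ℂ)) (g := fun x => (f x : ℂ)) (by fun_prop)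
    (by fun_prop)
  simp only [Complex.ofReal_sub] at h1
  rw [h2] at h1
  have := (Complex.le_def.1 h1).1
  simpa using this

/-- Positivity controls only nonnegative functions, so f is split into its positive and negative
parts. -/
lemma im_eq_zero (hI : IsState M I) {f : ℝ → ℝ} (hf : Continuous f) :
    (I fun x => (f x : ℂ)).im = 0 := by
  have h1 := hI.nonneg (fun x => max (f x) 0) (by fun_prop) fun x => le_max_right _ _
  have h2 := hI.nonneg (fun x => max (-f x) 0) (by fun_prop) fun x => le_max_right _ _
  have h3 := hI.map_sub (f := fun x => ((max (f x) 0 : ℝ) : ℂ))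
    (g := fun x => ((max (-f x) 0 : ℝ) : ℂ)) (by fun_prop) (by fun_prop)
  have e : (fun x => ((max (f x) 0 : ℝ) : ℂ) - ((max (-f x) 0 : ℝ) : ℂ)) = fun x => (f x : ℂ) := by
    ext x
    rw [← Complex.ofReal_sub]
    congr 1
    rcases le_total 0 (f x) with h | h
    · rw [max_eq_left h, max_eq_right (by linarith), sub_zero]
    · rw [max_eq_right h, max_eq_left (by linarith)]
      ring
  rw [e] at h3
  rw [h3, Complex.sub_im, ← (Complex.le_def.1 h1).2, ← (Complex.le_def.1 h2).2]
  simp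

lemma ofReal_re (hI : IsState M I) {f : ℝ → ℝ} (hf : Continuous f) :
    (((I fun x => (f x : ℂ)).re : ℝ) : ℂ) = I fun x => (f x : ℂ) :=
  Complex.ext rfl (by simp [hI.im_eq_zero hf])

/-- A functional is determined by its values on real functions. -/
lemma map_re_add_im (hI : IsState M I) {g : ℝ → ℂ} (hg : Continuous g) :
    I g = (I fun x => ((g x).re : ℂ)) + Complex.I * I fun x => ((g x).im : ℂ) := by
  rw [← hI.map_mul _ _ (by fun_prop), ← hI.map_add _ _ (by fun_prop) (by fun_prop)]
  congr 1
  ext x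
  rw [mul_comm]
  exact (Complex.re_add_im _).symm

end IsState

/-! ### Polynomial approximation and convergence of moments -/

lemma exists_polynomial_near {g : ℝ → ℂ} (hg : Continuous g) (M : ℝ) {ε : ℝ} (hε : 0 < ε) :
    ∃ q : Polynomial ℂ, ∀ x ∈ Set.Icc (-M) M, ‖g x - q.eval (x : ℂ)‖ ≤ ε := by
  obtain ⟨p₁, h₁⟩ := exists_polynomial_near_of_continuousOn (-M) M (fun x => (g x).re)
    (by fun_prop) (ε / 2) (by linarith)
  obtain ⟨p₂, h₂⟩ := exists_polynomial_near_of_continuousOn (-M) M (fun x => (g x).im)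
    (by fun_prop) (ε / 2) (by linarith)
  refine ⟨p₁.map (algebraMap ℝ ℂ) + Polynomial.C Complex.I * p₂.map (algebraMap ℝ ℂ),
    fun x hx => ?_⟩
  have e : ∀ p : Polynomial ℝ, (p.map (algebraMap ℝ ℂ)).eval (x : ℂ) = (p.eval x : ℝ) := by
    intro p
    exact (Polynomial.eval_map_algebraMap p (x : ℂ)).trans
      (Polynomial.aeval_algebraMap_apply ℂ x p)
  rw [Polynomial.eval_add, Polynomial.eval_mul, Polynomial.eval_C, e, e]
  refine (Complex.norm_le_abs_re_add_abs_im _).trans ?_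
  have k₁ := h₁ x hx
  have k₂ := h₂ x hx
  rw [abs_sub_comm] at k₁ k₂
  simp only [Complex.sub_re, Complex.add_re, Complex.ofReal_re, Complex.mul_re, Complex.I_re,
    Complex.I_im, Complex.ofReal_im, Complex.sub_im, Complex.add_im, Complex.mul_im, zero_mul,
    one_mul, mul_zero, sub_zero, zero_add, add_zero]
  linarith

/-- Convergence of the moments implies convergence on all continuous functions. -/
lemma IsState.tendsto_of_pow {ι : Type*} {l : Filter ι} {M : ℝ} {I : ι → (ℝ → ℂ) → ℂ}
    {J : (ℝ → ℂ) → ℂ} (hI : ∀ i, IsState M (I i)) (hJ : IsState M J)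
    (hpow : ∀ n : ℕ, Tendsto (fun i => I i fun x => (x : ℂ) ^ n) l (𝓝 (J fun x => (x : ℂ) ^ n)))
    {g : ℝ → ℂ} (hg : Continuous g) : Tendsto (fun i => I i g) l (𝓝 (J g)) := by
  have hpoly : ∀ q : Polynomial ℂ, Tendsto (fun i => I i fun x => q.eval (x : ℂ)) l
      (𝓝 (J fun x => q.eval (x : ℂ))) := by
    intro q
    induction q using Polynomial.induction_on' with
    | add p q hp hq =>
      have e : ∀ {K}, IsState M K → K (fun x => (p + q).eval (x : ℂ)) =
          K (fun x => p.eval (x : ℂ)) + K (fun x => q.eval (x : ℂ)) := by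
        intro K hK
        rw [← hK.map_add _ _ (by fun_prop) (by fun_prop)]
        simp only [Polynomial.eval_add]
      simp_rw [e (hI _), e hJ]
      exact hp.add hq
    | monomial n a =>
      have e : ∀ {K}, IsState M K → K (fun x => (Polynomial.monomial n a).eval (x : ℂ)) =
          a * K (fun x => (x : ℂ) ^ n) := by
        intro K hK
        rw [← hK.map_mul _ _ (by fun_prop)]
        simp only [Polynomial.eval_monomial]
      simp_rw [e (hI _), e hJ]
      exact (hpow n).const_mul a
  rw [Metric.tendsto_nhds]
  intro ε hε
  -- One polynomial serves every index, because all the states see the same interval [-M, M].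
  obtain ⟨q, hq⟩ := exists_polynomial_near hg M (ε := ε / 3) (by linarith)
  have hc : Continuous fun x : ℝ => q.eval (x : ℂ) := by fun_prop
  filter_upwards [Metric.tendsto_nhds.1 (hpoly q) (ε / 3) (by linarith)] with i hi
  have h1 := (hI i).norm_sub_le hg hc hq
  have h2 := hJ.norm_sub_le hg hc hq
  rw [dist_eq_norm] at hi ⊢
  calc ‖I i g - J g‖ = ‖(I i g - I i fun x => q.eval (x : ℂ)) +
        ((I i fun x => q.eval (x : ℂ)) - J fun x => q.eval (x : ℂ)) -
        (J g - J fun x => q.eval (x : ℂ))‖ := by congr 1; ring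
    _ ≤ ‖I i g - I i fun x => q.eval (x : ℂ)‖ +
        ‖(I i fun x => q.eval (x : ℂ)) - J fun x => q.eval (x : ℂ)‖ +
        ‖J g - J fun x => q.eval (x : ℂ)‖ := (_root_.norm_sub_le _ _).trans (by gcongr; exact norm_add_le _ _)
    _ < ε := by linarith

/-! ### The Riesz measure of a state -/

/-- A plateau function: equal to `1` on `[-R, R]` and to `0` outside `[-R - 1, R + 1]`. -/
def plateau (R x : ℝ) : ℝ := max 0 (min 1 (R + 1 - |x|))

lemma continuous_plateau (R : ℝ) : Continuous (plateau R) := by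
  unfold plateau
  fun_prop

lemma plateau_nonneg (R x : ℝ) : 0 ≤ plateau R x := le_max_left _ _

lemma plateau_le_one (R x : ℝ) : plateau R x ≤ 1 :=
  max_le zero_le_one (min_le_left _ _)

lemma plateau_eq_one {R x : ℝ} (h : x ∈ Set.Icc (-R) R) : plateau R x = 1 := by
  have := abs_le.2 h
  rw [plateau, min_eq_left (by linarith), max_eq_right zero_le_one]

lemma hasCompactSupport_plateau (R : ℝ) : HasCompactSupport (plateau R) := by
  refine HasCompactSupport.intro (isCompact_Icc (a := -(R + 1)) (b := R + 1)) fun x hx => ?_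
  have : R + 1 < |x| := lt_of_not_ge fun h => hx (abs_le.1 h)
  rw [plateau, min_eq_right (by linarith), max_eq_left (by linarith)]

namespace IsState

variable {M : ℝ} {I : (ℝ → ℂ) → ℂ}

/-- The restriction of a state to real functions of compact support. -/
def toPositiveLinearMap (hI : IsState M I) : C_c(ℝ, ℝ) →ₚ[ℝ] ℝ :=
  PositiveLinearMap.mk₀
    { toFun := fun f => (I fun x => (f x : ℂ)).re
      map_add' := fun f g => by
        rw [← Complex.add_re, ← hI.map_add _ _ (by fun_prop) (by fun_prop)]
        simp
      map_smul' := fun c f => by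
        have := hI.map_mul c (fun x => (f x : ℂ)) (by fun_prop)
        simp [this] }
    fun f hf => (Complex.le_def.1 (hI.nonneg f (by fun_prop) fun x => hf x)).1

/-- The Riesz measure of a state. -/
def measure (hI : IsState M I) : Measure ℝ := RealRMK.rieszMeasure hI.toPositiveLinearMap

instance (hI : IsState M I) : hI.measure.Regular :=
  RealRMK.regular_rieszMeasure _

lemma integral_compactlySupported (hI : IsState M I) {f : ℝ → ℝ} (hf : Continuous f)
    (hs : HasCompactSupport f) : ∫ x, f x ∂hI.measure = (I fun x => (f x : ℂ)).re :=
  RealRMK.integral_rieszMeasure hI.toPositiveLinearMap ⟨⟨f, hf⟩, hs⟩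

/-- The plateau is 1 on [-M, M], so `norm_sub_le` with bound 0 cannot tell it from the constant 1.
-/
lemma re_map_plateau (hI : IsState M I) : (I fun x => (plateau M x : ℂ)).re = 1 := by
  have := hI.norm_sub_le (f := fun x => (plateau M x : ℂ)) (g := fun _ => 1) (c := 0)
    (by have := continuous_plateau M; fun_prop) (by fun_prop)
    fun x hx => by simp [plateau_eq_one hx]
  rw [norm_le_zero_iff, sub_eq_zero, hI.map_one] at this
  simp [this]

lemma integrable_plateau (hI : IsState M I) (R : ℝ) : Integrable (plateau R) hI.measure :=
  (continuous_plateau R).integrable_of_hasCompactSupport (hasCompactSupport_plateau R)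

instance isProbabilityMeasure (hI : IsState M I) : IsProbabilityMeasure hI.measure := by
  -- Finiteness is not yet known, so the line is exhausted by intervals [-n, n], each of mass at
  -- most I(plateau n) ≤ I(1) = 1.
  have hle : ∀ n : ℕ, hI.measure (Set.Icc (-(n : ℝ)) n) ≤ 1 := by
    intro n
    have h1 : hI.measure.real (Set.Icc (-(n : ℝ)) n) ≤ ∫ x, plateau n x ∂hI.measure := by
      rw [← integral_indicator_one measurableSet_Icc]
      refine integral_mono ?_ (hI.integrable_plateau n) fun x => ?_
      · exact (integrable_indicator_iff measurableSet_Icc).2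
          (integrableOn_const isCompact_Icc.measure_lt_top.ne)
      · by_cases hx : x ∈ Set.Icc (-(n : ℝ)) n
        · simp [hx, plateau_eq_one hx]
        · simp [hx, plateau_nonneg]
    rw [hI.integral_compactlySupported (continuous_plateau n) (hasCompactSupport_plateau n)] at h1
    have h2 := hI.mono (continuous_plateau n) (g := fun _ => 1) (by fun_prop) (plateau_le_one _)
    simp only [Complex.ofReal_one, hI.map_one, Complex.one_re] at h2
    rw [← ENNReal.ofReal_one, ← ofReal_measureReal isCompact_Icc.measure_lt_top.ne]
    exact ENNReal.ofReal_le_ofReal (h1.trans h2)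
  have huniv : hI.measure Set.univ ≤ 1 := by
    have hU : (⋃ n : ℕ, Set.Icc (-(n : ℝ)) n) = Set.univ := by
      refine Set.eq_univ_of_forall fun x => ?_
      obtain ⟨n, hn⟩ := exists_nat_ge |x|
      exact Set.mem_iUnion.2 ⟨n, abs_le.1 hn⟩
    have hmono : Monotone fun n : ℕ => Set.Icc (-(n : ℝ)) n := fun m n hmn =>
      Set.Icc_subset_Icc (by simpa using hmn) (by simpa using hmn)
    rw [← hU, hmono.measure_iUnion]
    exact iSup_le hle
  have : IsFiniteMeasure hI.measure := ⟨huniv.trans_lt ENNReal.one_lt_top⟩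
  refine ⟨le_antisymm huniv ?_⟩
  -- Conversely, a function bounded by 1 already has integral 1.
  have h1 : ∫ x, plateau M x ∂hI.measure ≤ ∫ _, (1 : ℝ) ∂hI.measure :=
    integral_mono (hI.integrable_plateau M) (integrable_const _) fun x => plateau_le_one _ _
  rw [hI.integral_compactlySupported (continuous_plateau M) (hasCompactSupport_plateau M),
    hI.re_map_plateau, integral_const, smul_eq_mul, mul_one] at h1
  rw [← ENNReal.ofReal_one, ← ofReal_measureReal]
  exact ENNReal.ofReal_le_ofReal h1

/-- The nonnegative function 1 - plateau has integral 0. Hence any continuous function may be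
multiplied by the plateau without changing its integral, which reduces it to compact support. -/
lemma ae_plateau_eq_one (hI : IsState M I) : ∀ᵐ x ∂hI.measure, plateau M x = 1 := by
  have h0 : ∫ x, (1 - plateau M x) ∂hI.measure = 0 := by
    rw [integral_sub (integrable_const _) (hI.integrable_plateau M),
      hI.integral_compactlySupported (continuous_plateau M) (hasCompactSupport_plateau M),
      hI.re_map_plateau]
    simp
  rw [integral_eq_zero_iff_of_nonneg (fun x => sub_nonneg.2 (plateau_le_one M x))
    ((integrable_const _).sub (hI.integrable_plateau M))] at h0
  filter_upwards [h0] with x hx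
  exact (sub_eq_zero.1 hx).symm

lemma integral_ofReal (hI : IsState M I) {f : ℝ → ℝ} (hf : Continuous f) :
    ∫ x, (f x : ℂ) ∂hI.measure = I fun x => (f x : ℂ) := by
  have hp := continuous_plateau M
  have h1 : ∫ x, f x ∂hI.measure = ∫ x, plateau M x * f x ∂hI.measure := by
    refine integral_congr_ae ?_
    filter_upwards [hI.ae_plateau_eq_one] with x hx
    rw [hx, one_mul]
  rw [integral_complex_ofReal, h1, hI.integral_compactlySupported (f := fun x => plateau M x * f x) (hp.mul hf)
    (hasCompactSupport_plateau M).mul_right, hI.ofReal_re (f := fun x => plateau M x * f x) (hp.mul hf)]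
  have := hI.norm_sub_le (f := fun x => ((plateau M x * f x : ℝ) : ℂ)) (g := fun x => (f x : ℂ))
    (c := 0) (by fun_prop) (by fun_prop) fun x hx => by simp [plateau_eq_one hx]
  exact sub_eq_zero.1 (norm_le_zero_iff.1 this)

lemma integrable (hI : IsState M I) {g : ℝ → ℂ} (hg : Continuous g) :
    Integrable g hI.measure := by
  have hp := continuous_plateau M
  have h1 : Integrable (fun x => (plateau M x : ℂ) * g x) hI.measure := by
    refine Continuous.integrable_of_hasCompactSupport (by fun_prop) ?_
    exact ((hasCompactSupport_plateau M).comp_left Complex.ofReal_zero).mul_right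
  refine h1.congr ?_
  filter_upwards [hI.ae_plateau_eq_one] with x hx
  rw [hx, Complex.ofReal_one, one_mul]

/-- A state is the integral against its Riesz measure. -/
lemma integral_eq (hI : IsState M I) {g : ℝ → ℂ} (hg : Continuous g) :
    ∫ x, g x ∂hI.measure = I g := by
  rw [hI.map_re_add_im hg, ← hI.integral_ofReal (by fun_prop), ← hI.integral_ofReal (by fun_prop),
    ← integral_const_mul, ← integral_add]
  · congr 1
    ext x
    rw [mul_comm]
    exact (Complex.re_add_im _).symm
  · exact hI.integrable (by fun_prop)
  · exact hI.integrable (by fun_prop)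

lemma isRadonMeasureOf (hI : IsState M I) : IsRadonMeasureOf I hI.measure :=
  ⟨inferInstance, fun g => hI.integral_eq g.continuous⟩

end IsState

/-! ### Spectral functionals -/

lemma norm_delta (x : Site) : ‖delta x‖ = 1 := by
  simp [delta, lp.norm_single]

lemma inner_delta_left (x : Site) (ψ : Space) : ⟪delta x, ψ⟫_ℂ = ψ x := by
  simp [delta, lp.inner_single_left]

lemma diag_eq (g : ℝ → ℂ) (A : Space →L[ℂ] Space) (x : Site) :
    diag g A x = opFun g A (delta x) x :=
  inner_delta_left _ _

instance : Nontrivial Space :=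
  ⟨delta (.inl 0), 0, norm_ne_zero_iff.1 (by simp [norm_delta])⟩

/-- `opFun` evaluates g at the real part, which is the identity on the real spectrum of a
self-adjoint operator. -/
lemma opFun_pow {A : Space →L[ℂ] Space} (hA : IsSelfAdjoint A) (n : ℕ) :
    opFun (fun x => (x : ℂ) ^ n) A = A ^ n := by
  have hn : IsStarNormal A := hA.isStarNormal
  rw [opFun, ← cfc_pow_id (R := ℂ) A n hn]
  refine cfc_congr fun z hz => ?_
  rw [← hA.mem_spectrum_eq_re hz]

/-- The spectral functional of a self-adjoint operator at a site is a state. -/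
lemma isState_diag {A : Space →L[ℂ] Space} (hA : IsSelfAdjoint A) {M : ℝ} (hM : ‖A‖ ≤ M)
    (x : Site) : IsState M fun g => diag g A x := by
  have hn : IsStarNormal A := hA.isStarNormal
  refine ⟨fun f g hf hg => ?_, fun c f hf => ?_, ?_, fun f hf h0 => ?_, fun f c hf hc => ?_⟩
  · simp only [diag, opFun]
    rw [cfc_add (a := A) (fun z : ℂ => f z.re) (fun z : ℂ => g z.re)
      (hf.comp Complex.continuous_re).continuousOn (hg.comp Complex.continuous_re).continuousOn,
      add_apply, inner_add_right]
  · simp only [diag, opFun]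
    rw [cfc_const_mul c (fun z : ℂ => f z.re) A (hf.comp Complex.continuous_re).continuousOn,
      smul_apply, inner_smul_right]
  · simp only [diag, opFun]
    rw [cfc_const_one ℂ A]
    simp [norm_delta]
  · simp only [diag, opFun]
    have h1 : 0 ≤ cfc (fun z : ℂ => (f z.re : ℂ)) A :=
      cfc_nonneg fun z _ => Complex.zero_le_real.2 (h0 _)
    exact ((ContinuousLinearMap.nonneg_iff_isPositive _).1 h1).inner_nonneg_right _
  · have hM0 : 0 ≤ M := (norm_nonneg A).trans hM
    have hc0 : 0 ≤ c := (norm_nonneg _).trans (hc 0 ⟨by linarith, hM0⟩)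
    have h1 : ‖opFun f A‖ ≤ c := by
      -- The spectrum lies in the disc of radius ‖A‖ ≤ M, so only values of f on [-M, M] matter.
      refine norm_cfc_le hc0 fun z hz => hc _ (abs_le.1 ?_)
      exact (Complex.abs_re_le_norm z).trans ((spectrum.norm_le_norm_of_mem hz).trans hM)
    calc ‖diag f A x‖ ≤ ‖delta x‖ * ‖opFun f A (delta x)‖ := norm_inner_le_norm _ _
      _ ≤ ‖delta x‖ * (‖opFun f A‖ * ‖delta x‖) := by
          gcongr
          exact ContinuousLinearMap.le_opNorm _ _
      _ ≤ c := by simpa [norm_delta] using h1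

lemma norm_average_le {ι : Type*} (s : Finset ι) (hs : s.Nonempty) {f : ι → ℂ} {c : ℝ}
    (h : ∀ i ∈ s, ‖f i‖ ≤ c) : ‖(s.card : ℂ)⁻¹ * ∑ i ∈ s, f i‖ ≤ c := by
  rw [norm_mul, norm_inv, Complex.norm_natCast, inv_mul_le_iff₀ (by exact_mod_cast hs.card_pos),
    ← nsmul_eq_mul, ← Finset.sum_const]
  exact norm_sum_le_of_le _ h

lemma IsState.average {ι : Type*} {M : ℝ} {I : ι → (ℝ → ℂ) → ℂ} {s : Finset ι}
    (hs : s.Nonempty) (hI : ∀ i, IsState M (I i)) :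
    IsState M fun g => (s.card : ℂ)⁻¹ * ∑ i ∈ s, I i g := by
  have hc : (s.card : ℂ) ≠ 0 := Nat.cast_ne_zero.2 hs.card_ne_zero
  refine ⟨fun f g hf hg => ?_, fun c f hf => ?_, ?_, fun f hf h0 => ?_, fun f c hf h => ?_⟩
  · simp_rw [(hI _).map_add f g hf hg, Finset.sum_add_distrib, mul_add]
  · simp_rw [(hI _).map_mul c f hf, ← Finset.mul_sum, mul_left_comm c]
  · simp_rw [(hI _).map_one]
    simp [hc]
  · refine mul_nonneg ?_ (Finset.sum_nonneg fun i _ => (hI i).nonneg f hf h0)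
    rw [← Complex.ofReal_natCast, ← Complex.ofReal_inv]
    exact Complex.zero_le_real.2 (by positivity)
  · exact norm_average_le s hs fun i _ => (hI i).norm_le f c hf h

/-! ### Equidistribution -/

/-- Geometric sum; what matters is that the bound does not depend on the length of the interval. -/
lemma norm_sum_zpow_le {z : ℂ} (hz : ‖z‖ = 1) (hz1 : z ≠ 1) (u v : ℤ) :
    ‖∑ n ∈ Finset.Icc u v, z ^ n‖ ≤ 2 / ‖z - 1‖ := by
  have hz0 : z ≠ 0 := by
    rintro rfl
    simp at hz
  have e : ∑ n ∈ Finset.Icc u v, z ^ n =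
      z ^ u * ∑ k ∈ Finset.range (v + 1 - u).toNat, z ^ k := by
    rw [Int.Icc_eq_finset_map, Finset.sum_map, Finset.mul_sum]
    refine Finset.sum_congr rfl fun k _ => ?_
    simp [zpow_add₀ hz0]
  rw [e, geom_sum_eq hz1, norm_mul, norm_zpow, hz, one_zpow, one_mul, norm_div]
  gcongr
  refine (norm_sub_le _ _).trans ?_
  simp [hz, one_add_one_eq_two]

/-- Equidistribution of an irrational rotation for one character. -/
lemma tendsto_average_fourier {T α : ℝ} (hT : 0 < T) (hα : Irrational (α / T)) (β : ℝ)
    {ι : Type*} {l : Filter ι} {u v : ι → ℤ}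
    (hcard : Tendsto (fun i => ((Finset.Icc (u i) (v i)).card : ℝ)) l atTop) (k : ℤ) :
    Tendsto (fun i => ((Finset.Icc (u i) (v i)).card : ℂ)⁻¹ *
        ∑ n ∈ Finset.Icc (u i) (v i), fourier k ((β + n * α : ℝ) : AddCircle T)) l
      (𝓝 (((1 / T : ℝ) : ℂ) * ∫ b in Set.Ico 0 T, fourier k (b : AddCircle T))) := by
  have hT' : (T : ℂ) ≠ 0 := by exact_mod_cast hT.ne'
  rcases eq_or_ne k 0 with rfl | hk
  · simp only [fourier_zero, Finset.sum_const, nsmul_eq_mul, mul_one]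
    have e : ((1 / T : ℝ) : ℂ) * ∫ _ in Set.Ico 0 T, (1 : ℂ) = 1 := by
      rw [setIntegral_const]
      simp [hT.le, hT']
    rw [e]
    refine tendsto_const_nhds.congr' ?_
    filter_upwards [hcard.eventually_gt_atTop 0] with i hi
    have : ((Finset.Icc (u i) (v i)).card : ℂ) ≠ 0 := by
      have := hi.ne'
      exact_mod_cast this
    rw [inv_mul_cancel₀ this]
  -- A nontrivial character has mean zero, so it remains to show that its orbit averages tend to 0.
  · have hint : ∫ b in Set.Ico 0 T, fourier k (b : AddCircle T) = 0 := by
      rw [integral_Ico_eq_integral_Ioc, ← intervalIntegral.integral_of_le hT.le]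
      have hc : (2 * Real.pi * Complex.I * k / T : ℂ) ≠ 0 := by
        simp [Real.pi_ne_zero, Complex.I_ne_zero, hk, hT']
      have e : ∀ b : ℝ, fourier k (b : AddCircle T) =
          Complex.exp ((2 * Real.pi * Complex.I * k / T : ℂ) * b) := by
        intro b
        rw [fourier_coe_apply]
        congr 1
        ring
      simp_rw [e]
      rw [integral_exp_mul_complex hc, div_mul_cancel₀ _ hT',
        show (2 * Real.pi * Complex.I * k : ℂ) = k * (2 * Real.pi * Complex.I) by ring,
        Complex.exp_int_mul_two_pi_mul_I]
      simp
    rw [hint, mul_zero]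
    set z : ℂ := Complex.exp ((2 * Real.pi * (k * (α / T)) : ℝ) * Complex.I) with hz
    have hznorm : ‖z‖ = 1 := Complex.norm_exp_ofReal_mul_I _
    have hz1 : z ≠ 1 := by
      -- z = 1 would make k α / T an integer, against the irrationality of α / T.
      intro h
      obtain ⟨m, hm⟩ := Complex.exp_eq_one_iff.1 h
      have h2 : (k * (α / T) : ℝ) = m := by
        have h3 : ((k * (α / T) : ℝ) : ℂ) * (2 * Real.pi * Complex.I) =
            (m : ℂ) * (2 * Real.pi * Complex.I) := by
          rw [← hm]
          push_cast
          ring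
        have h4 := mul_right_cancel₀ Complex.two_pi_I_ne_zero h3
        exact_mod_cast h4
      exact (hα.intCast_mul hk).ne_int m h2
    have e : ∀ n : ℤ, fourier k ((β + n * α : ℝ) : AddCircle T) =
        fourier k ((β : ℝ) : AddCircle T) * z ^ n := by
      intro n
      rw [fourier_coe_apply, fourier_coe_apply, hz, ← Complex.exp_int_mul, ← Complex.exp_add]
      congr 1
      push_cast
      field_simp
    refine squeeze_zero_norm (a := fun i => ((Finset.Icc (u i) (v i)).card : ℝ)⁻¹ *
      (2 / ‖z - 1‖)) (fun i => ?_) ?_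
    · simp_rw [e, ← Finset.mul_sum]
      rw [norm_mul, norm_mul, norm_inv, Complex.norm_natCast, fourier_apply, Circle.norm_coe,
        one_mul]
      gcongr
      exact norm_sum_zpow_le hznorm hz1 _ _
    · simpa using (tendsto_inv_atTop_zero.comp hcard).mul_const (2 / ‖z - 1‖)

lemma norm_setAverage_le {T : ℝ} (hT : 0 < T) {f : ℝ → ℂ} {c : ℝ} (h : ∀ b, ‖f b‖ ≤ c) :
    ‖((1 / T : ℝ) : ℂ) * ∫ b in Set.Ico 0 T, f b‖ ≤ c := by
  have := norm_setIntegral_le_of_norm_le_const (μ := volume) (s := Set.Ico 0 T) (f := f) (C := c)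
    (by simp) fun b _ => h b
  rw [norm_mul, Complex.norm_real, Real.norm_of_nonneg (by positivity), one_div,
    inv_mul_le_iff₀ hT]
  simpa [hT.le, mul_comm] using this

/-- **Weyl's equidistribution theorem**: the averages of a continuous periodic function along an
irrational rotation converge to its mean. -/
theorem tendsto_average_of_periodic {T α : ℝ} (hT : 0 < T) (hα : Irrational (α / T)) {F : ℝ → ℂ}
    (hF : Continuous F) (hper : F.Periodic T) (β : ℝ) {ι : Type*} {l : Filter ι} {u v : ι → ℤ}
    (hcard : Tendsto (fun i => ((Finset.Icc (u i) (v i)).card : ℝ)) l atTop) :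
    Tendsto (fun i => ((Finset.Icc (u i) (v i)).card : ℂ)⁻¹ *
        ∑ n ∈ Finset.Icc (u i) (v i), F (β + n * α)) l
      (𝓝 (((1 / T : ℝ) : ℂ) * ∫ b in Set.Ico 0 T, F b)) := by
  have : Fact (0 < T) := ⟨hT⟩
  let A : ι → C(AddCircle T, ℂ) → ℂ := fun i f => ((Finset.Icc (u i) (v i)).card : ℂ)⁻¹ *
        ∑ n ∈ Finset.Icc (u i) (v i), f ((β + n * α : ℝ) : AddCircle T)
  let J : C(AddCircle T, ℂ) → ℂ := fun f =>
    ((1 / T : ℝ) : ℂ) * ∫ b in Set.Ico 0 T, f (b : AddCircle T)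
  have hint : ∀ f : C(AddCircle T, ℂ), IntegrableOn (fun b : ℝ => f (b : AddCircle T))
      (Set.Ico 0 T) := fun f =>
    ((f.continuous.comp (AddCircle.continuous_mk' T)).continuousOn.integrableOn_Icc).mono_set
      Set.Ico_subset_Icc_self
  have hAsub : ∀ i f g, A i (f - g) = A i f - A i g := fun i f g => by
    simp [A, Finset.sum_sub_distrib, mul_sub]
  have hJsub : ∀ f g, J (f - g) = J f - J g := fun f g => by
    simp only [J, ContinuousMap.sub_apply]
    rw [integral_sub (hint f) (hint g), mul_sub]
  have hA : ∀ i f, ‖A i f‖ ≤ ‖f‖ := fun i f =>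
    by
      rcases (Finset.Icc (u i) (v i)).eq_empty_or_nonempty with hs | hs
      · simp [A, hs]
      · exact norm_average_le _ hs fun n _ => f.norm_coe_le_norm _
  have hJ : ∀ f, ‖J f‖ ≤ ‖f‖ := fun f => norm_setAverage_le hT fun b => f.norm_coe_le_norm _
  have hspan : ∀ f ∈ Submodule.span ℂ (Set.range (@fourier T)),
      Tendsto (fun i => A i f) l (𝓝 (J f)) := by
    intro f hf
    induction hf using Submodule.span_induction with
    | mem f hf =>
      obtain ⟨k, rfl⟩ := hf
      exact tendsto_average_fourier hT hα β hcard k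
    | zero => simpa [A, J] using tendsto_const_nhds
    | add f g _ _ hf hg =>
      have e : J (f + g) = J f + J g := by
        simp only [J, ContinuousMap.add_apply]
        rw [integral_add (hint f) (hint g), mul_add]
      rw [e]
      refine (hf.add hg).congr fun i => ?_
      simp [A, Finset.sum_add_distrib, mul_add]
    | smul c f _ hf =>
      have e : J (c • f) = c * J f := by
        simp only [J, ContinuousMap.smul_apply, smul_eq_mul]
        rw [integral_const_mul, mul_left_comm]
      rw [e]
      refine (hf.const_mul c).congr fun i => ?_
      simp [A, Finset.mul_sum, mul_left_comm c]
  let f : C(AddCircle T, ℂ) := ⟨hper.lift, continuous_quot_lift _ hF⟩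
  have key : Tendsto (fun i => A i f) l (𝓝 (J f)) := by
    rw [Metric.tendsto_nhds]
    intro ε hε
    -- Trigonometric polynomials are dense, and both averages are contractions for the sup norm.
    have hmem : f ∈ (Submodule.span ℂ (Set.range (@fourier T))).topologicalClosure := by
      rw [span_fourier_closure_eq_top]
      trivial
    obtain ⟨q, hq, hfq⟩ := Metric.mem_closure_iff.1 hmem (ε / 3) (by linarith)
    rw [dist_eq_norm] at hfq
    filter_upwards [Metric.tendsto_nhds.1 (hspan q hq) (ε / 3) (by linarith)] with i hi
    have h1 := hA i (f - q)
    have h2 := hJ (f - q)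
    rw [hAsub] at h1
    rw [hJsub] at h2
    rw [dist_eq_norm] at hi ⊢
    calc ‖A i f - J f‖ = ‖(A i f - A i q) + (A i q - J q) - (J f - J q)‖ := by congr 1; ring
      _ ≤ ‖A i f - A i q‖ + ‖A i q - J q‖ + ‖J f - J q‖ :=
        (norm_sub_le _ _).trans (by gcongr; exact norm_add_le _ _)
      _ < ε := by linarith
  exact key

/-! ### Decay of the matrix of the Hamiltonian -/

/-- The position of a site on the line, relative to chain `1`. -/
def position (θ b : ℝ) : Site → ℝ
  | .inl n => n
  | .inr n => (1 - θ) * n + b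

/-- In the common coordinate `position`, the two truncation intervals become the same interval [-L,
L]. -/
lemma mem_box_iff {θ : ℝ} (hθ : θ < 1) (b L : ℝ) (x : Site) :
    x ∈ box θ b L ↔ position θ b x ∈ Set.Icc (-L) L := by
  have h1 : 0 < 1 - θ := by linarith
  rcases x with n | n
  · exact inl_mem_box θ b L n
  · rw [inr_mem_box, Set.mem_Icc, Set.mem_Icc, position, neg_le, le_div_iff₀ h1, le_div_iff₀ h1]
    constructor <;> rintro ⟨h2, h3⟩ <;> constructor <;> linarith

lemma exists_kernel_le {θ : ℝ} (hθ0 : 0 < θ) (hθ : θ < 1) (h : InterlayerHopping) :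
    ∃ C γ : ℝ, 0 < γ ∧ ∀ b x y, ‖kernel θ h b x y‖ ≤
      C * Real.exp (-γ * |position θ b x - position θ b y|) := by
  obtain ⟨C, γ, hγ, hC⟩ := h.decay
  -- Neighbours in a chain are at distance a ≤ 1, so a constant of at least exp γ puts the hopping
  -- amplitude 1 under the same exponential as h.
  have hop : ∀ (a b : ℝ) (n m : ℤ), 0 < a → a ≤ 1 →
      ‖(if m = n + 1 ∨ m = n - 1 then 1 else 0 : ℂ)‖ ≤
        max C (Real.exp γ) * Real.exp (-γ * |(a * n + b) - (a * m + b)|) := by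
    intro a b n m ha ha1
    split_ifs with hm
    · have hd : |(a * n + b) - (a * m + b)| ≤ 1 := by
        rcases hm with rfl | rfl
        · push_cast
          rw [abs_le]
          constructor <;> linarith
        · push_cast
          rw [abs_le]
          constructor <;> linarith
      rw [norm_one]
      calc (1 : ℝ) = Real.exp γ * Real.exp (-γ * 1) := by rw [← Real.exp_add]; simp
        _ ≤ _ := by
            gcongr ?_ * Real.exp ?_
            · exact le_max_right _ _
            · nlinarith
    · rw [norm_zero]
      positivity
  have inter : ∀ η : ℝ, ‖(h η : ℂ)‖ ≤ max C (Real.exp γ) * Real.exp (-γ * |η|) := by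
    intro η
    rw [Complex.norm_real]
    refine (hC η).trans ?_
    gcongr
    exact le_max_left _ _
  refine ⟨max C (Real.exp γ), γ, hγ, fun b x y => ?_⟩
  rcases x with n | n <;> rcases y with m | m
  · simpa [kernel, position] using hop 1 0 n m one_pos le_rfl
  · rw [show position θ b (.inl n) - position θ b (.inr m) = n - (1 - θ) * m - b by
      simp only [position]; ring]
    exact inter _
  · rw [abs_sub_comm, show position θ b (.inl m) - position θ b (.inr n) = m - (1 - θ) * n - b by
      simp only [position]; ring]
    exact inter _
  · exact hop (1 - θ) b n m (by linarith) (by linarith)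

lemma exists_tsum_exp_position_le {θ : ℝ} (hθ : θ < 1) {γ : ℝ} (hγ : 0 < γ) :
    ∃ B : ℝ≥0, ∀ b t : ℝ,
      ∑' y, ENNReal.ofReal (Real.exp (-γ * |t - position θ b y|)) ≤ B := by
  obtain ⟨B₁, h₁⟩ := exists_tsum_exp_le (a := 1) one_pos hγ
  obtain ⟨B₂, h₂⟩ := exists_tsum_exp_le (a := 1 - θ) (by linarith) hγ
  refine ⟨B₁ + B₂, fun b t => ?_⟩
  rw [ENNReal.summable.tsum_sum ENNReal.summable, ENNReal.coe_add]
  refine add_le_add ?_ ?_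
  · simpa [position] using h₁ t
  · refine le_of_eq_of_le (tsum_congr fun m => ?_) (h₂ (t - b))
    rw [show t - position θ b (.inr m) = t - b - (1 - θ) * m by simp only [position]; ring]

lemma norm_schurOp_le {K : Site → Site → ℂ} (hK : IsSchurKernel K) {C : ℝ≥0}
    (h1 : ∀ i, ∑' j, ‖K i j‖ₑ ≤ C) (h2 : ∀ j, ∑' i, ‖K i j‖ₑ ≤ C) : ‖schurOp K hK‖ ≤ C := by
  refine ContinuousLinearMap.opNorm_le_bound _ C.2 fun ψ => ?_
  have h := tsum_enorm_apply_sq_le h1 h2 ψ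
  change _ ≤ (C : ℝ) * _
  rw [← coe_nnnorm, ← coe_nnnorm, ← NNReal.coe_mul, NNReal.coe_le_coe, ← enorm_le_coe,
    ENNReal.coe_mul]
  refine (ENNReal.pow_le_pow_left_iff two_ne_zero).1 ?_
  rw [← tsum_enorm_sq]
  exact h

lemma enorm_kernel_le {θ : ℝ} {h : InterlayerHopping} {C γ : ℝ}
    (hC : ∀ b x y, ‖kernel θ h b x y‖ ≤ C * Real.exp (-γ * |position θ b x - position θ b y|))
    (b : ℝ) (x y : Site) : ‖kernel θ h b x y‖ₑ ≤
      ENNReal.ofReal C * ENNReal.ofReal (Real.exp (-γ * |position θ b x - position θ b y|)) := by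
  rw [← ENNReal.ofReal_mul' (Real.exp_pos _).le, ← ofReal_norm]
  exact ENNReal.ofReal_le_ofReal (hC _ _ _)

/-- Uniformity in b puts all shifts under one `IsState M`; 1 ≤ M makes the powers of M increasing,
as the induction in `norm_sum_pow_sub_le` requires. -/
lemma exists_norm_hamiltonian_le {θ : ℝ} (hθ0 : 0 < θ) (hθ : θ < 1) (h : InterlayerHopping) :
    ∃ M : ℝ, 1 ≤ M ∧ ∀ b, ‖hamiltonian θ hθ h b‖ ≤ M := by
  obtain ⟨C, γ, hγ, hC⟩ := exists_kernel_le hθ0 hθ h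
  obtain ⟨B, hB⟩ := exists_tsum_exp_position_le hθ hγ
  have row : ∀ b x, ∑' y, ‖kernel θ h b x y‖ₑ ≤ (C.toNNReal * B : ℝ≥0) := by
    intro b x
    refine (ENNReal.tsum_le_tsum fun y => enorm_kernel_le hC b x y).trans ?_
    rw [ENNReal.tsum_mul_left, ENNReal.coe_mul]
    gcongr
    · exact le_rfl
    · exact hB _ _
  refine ⟨max 1 (C.toNNReal * B : ℝ≥0), le_max_left _ _, fun b => ?_⟩
  refine (norm_schurOp_le _ (row b) fun y => ?_).trans (le_max_right _ _)
  simp_rw [kernel_symm θ h b y]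
  exact row b y

/-! ### Continuity of matrix elements in the shift -/

lemma norm_coord_le (ψ : Space) (x : Site) : ‖ψ x‖ ≤ ‖ψ‖ :=
  lp.norm_apply_le_norm two_ne_zero ψ x

lemma norm_pow_delta_le {A : Space →L[ℂ] Space} {M : ℝ} (hM : ‖A‖ ≤ M) (n : ℕ)
    (x y : Site) : ‖(A ^ n) (delta y) x‖ ≤ M ^ n := by
  refine (norm_coord_le _ _).trans ((ContinuousLinearMap.le_opNorm _ _).trans ?_)
  rw [norm_delta, mul_one]
  refine (norm_pow_le A n).trans ?_
  gcongr

lemma continuous_kernel (θ : ℝ) (h : InterlayerHopping) (x y : Site) :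
    Continuous fun b => kernel θ h b x y := by
  have := h.smooth.continuous
  rcases x with n | n <;> rcases y with m | m <;> simp only [kernel] <;> fun_prop

/-- This transfers the decay bound from a varying shift b to a fixed shift c, as domination
requires. -/
lemma abs_position_sub_le (θ b c : ℝ) (x y : Site) :
    |position θ c x - position θ c y| - |b - c| ≤ |position θ b x - position θ b y| := by
  have h : ∀ s t : ℝ, |s - t| ≤ |b - c| → |t| - |b - c| ≤ |s| := fun s t hst => by
    have := abs_sub_abs_le_abs_sub t s
    rw [abs_sub_comm] at this
    linarith
  refine h _ _ ?_
  rcases x with n | n <;> rcases y with m | m <;> simp only [position]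
  · simp
  · rw [show (n : ℝ) - ((1 - θ) * m + b) - (n - ((1 - θ) * m + c)) = -(b - c) by ring, abs_neg]
  · rw [show (1 - θ) * n + b - m - ((1 - θ) * n + c - m) = b - c by ring]
  · rw [show (1 - θ) * n + b - ((1 - θ) * m + b) - ((1 - θ) * n + c - ((1 - θ) * m + c)) = 0 by ring,
      abs_zero]
    exact abs_nonneg _

/-- The matrix elements of the powers of `H(b)` depend continuously on `b`. -/
lemma continuous_pow_hamiltonian {θ : ℝ} (hθ0 : 0 < θ) (hθ : θ < 1) (h : InterlayerHopping)
    (n : ℕ) (x y : Site) : Continuous fun b => (hamiltonian θ hθ h b ^ n) (delta y) x := by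
  obtain ⟨C, γ, hγ, hC⟩ := exists_kernel_le hθ0 hθ h
  obtain ⟨B, hB⟩ := exists_tsum_exp_position_le hθ hγ
  obtain ⟨M, hM1, hM⟩ := exists_norm_hamiltonian_le hθ0 hθ h
  induction n generalizing x with
  | zero => exact continuous_const
  | succ n ih =>
    have e : ∀ b, (hamiltonian θ hθ h b ^ (n + 1)) (delta y) x =
        ∑' z, kernel θ h b x z * (hamiltonian θ hθ h b ^ n) (delta y) z := by
      intro b
      rw [pow_succ']
      rfl
    simp_rw [e]
    refine continuous_iff_continuousAt.2 fun c => ?_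
    have hsum : Summable fun z => Real.exp (-γ * |position θ c x - position θ c z|) := by
      refine Summable.of_enorm (ne_top_of_le_ne_top ENNReal.coe_ne_top ((le_of_eq ?_).trans
        (hB c (position θ c x))))
      simp_rw [Real.enorm_of_nonneg (Real.exp_pos _).le]
    -- The factor exp γ pays for replacing the shift b by c when |b - c| < 1.
    refine tendsto_tsum_of_dominated_convergence
      (bound := fun z => |C| * (Real.exp γ * Real.exp (-γ * |position θ c x - position θ c z|)) *
        M ^ n) (((hsum.mul_left _).mul_left _).mul_right _) (fun z => ?_) ?_
    · exact ((continuous_kernel θ h x z).mul (ih z)).tendsto c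
    · filter_upwards [Metric.ball_mem_nhds c one_pos] with b hb z
      rw [Metric.mem_ball, Real.dist_eq] at hb
      rw [norm_mul]
      gcongr
      · refine (hC b x z).trans ?_
        rw [← Real.exp_add]
        gcongr ?_ * Real.exp ?_
        · exact le_abs_self C
        · nlinarith [abs_position_sub_le θ b c x z]
      · exact norm_pow_delta_le (hM b) n z y

/-! ### Covariance under shifts -/

/-- A permutation of the sites carrying one kernel to the other conjugates the operators; on matrix
elements this is a reindexing of the matrix product. -/
lemma pow_hamiltonian_of_kernel_eq {θ : ℝ} (hθ : θ < 1) (h : InterlayerHopping) {b c : ℝ}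
    (σ : Site ≃ Site) (hσ : ∀ x y, kernel θ h b (σ x) (σ y) = kernel θ h c x y) (n : ℕ)
    (x y : Site) :
    (hamiltonian θ hθ h b ^ n) (delta (σ y)) (σ x) = (hamiltonian θ hθ h c ^ n) (delta y) x := by
  induction n generalizing x with
  | zero =>
    change delta (σ y) (σ x) = delta y x
    simp [delta, Pi.single_apply]
  | succ n ih =>
    have e : ∀ b x y, (hamiltonian θ hθ h b ^ (n + 1)) (delta y) x =
        ∑' z, kernel θ h b x z * (hamiltonian θ hθ h b ^ n) (delta y) z := by
      intro b x y
      rw [pow_succ']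
      rfl
    rw [e, e, ← σ.tsum_eq]
    exact tsum_congr fun z => by rw [hσ, ih]

/-- The shift of chain `1` by `n` sites and of chain `2` by `m` sites. -/
def shift (n m : ℤ) : Site ≃ Site := (Equiv.addRight n).sumCongr (Equiv.addRight m)

/-- Interlayer hopping depends only on n₁ - (1 - θ) n₂ - b, so translations of the chains are
absorbed into b. -/
lemma kernel_shift (θ : ℝ) (h : InterlayerHopping) (b : ℝ) (n m : ℤ) (x y : Site) :
    kernel θ h b (shift n m x) (shift n m y) = kernel θ h (b - n + (1 - θ) * m) x y := by
  rcases x with k | k <;> rcases y with l | l <;>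
    simp only [shift, kernel, Equiv.sumCongr_apply, Sum.map_inl, Sum.map_inr, Equiv.coe_addRight]
  · congr 1
    exact propext ⟨fun h => by omega, fun h => by omega⟩
  · push_cast
    ring_nf
  · push_cast
    ring_nf
  · congr 1
    exact propext ⟨fun h => by omega, fun h => by omega⟩

/-! ### Truncations -/

lemma restrict_eq_sum (S : Finset Site) (ψ : Space) : restrict S ψ = ∑ x ∈ S, ψ x • delta x := by
  simp [restrict, inner_delta_left]

lemma norm_restrict_le (S : Finset Site) : ‖restrict S‖ ≤ 1 := by
  refine ContinuousLinearMap.opNorm_le_bound _ zero_le_one fun ψ => ?_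
  rw [one_mul, ← coe_nnnorm, ← coe_nnnorm, NNReal.coe_le_coe, ← enorm_le_coe]
  refine (ENNReal.pow_le_pow_left_iff two_ne_zero).1 ?_
  change _ ≤ ‖ψ‖ₑ ^ 2
  rw [← tsum_enorm_sq, ← tsum_enorm_sq]
  refine ENNReal.tsum_le_tsum fun x => ?_
  rw [restrict_apply]
  split_ifs
  · exact le_rfl
  · simp

lemma restrict_isSelfAdjoint (S : Finset Site) : IsSelfAdjoint (restrict S) := by
  rw [ContinuousLinearMap.isSelfAdjoint_iff_isSymmetric]
  intro φ ψ
  change ⟪restrict S φ, ψ⟫_ℂ = ⟪φ, restrict S ψ⟫_ℂ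
  rw [lp.inner_eq_tsum, lp.inner_eq_tsum]
  refine tsum_congr fun x => ?_
  rw [restrict_apply, restrict_apply]
  split_ifs <;> simp

lemma restrict_mul_self (S : Finset Site) : restrict S * restrict S = restrict S := by
  ext ψ x
  change restrict S (restrict S ψ) x = restrict S ψ x
  rw [restrict_apply, restrict_apply]
  split_ifs <;> rfl

lemma restrict_delta {S : Finset Site} {x : Site} (hx : x ∈ S) :
    restrict S (delta x) = delta x := by
  ext y
  rw [restrict_apply]
  split_ifs with hy
  · rfl
  · have : y ≠ x := fun e => hy (e ▸ hx)
    simp [delta, this]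

lemma truncated_isSelfAdjoint (θ : ℝ) (hθ : θ < 1) (h : InterlayerHopping) (b L : ℝ) :
    IsSelfAdjoint (truncated θ hθ h b L) := by
  have := (hamiltonian_isSelfAdjoint θ hθ h b).conjugate (restrict (box θ b L))
  rwa [(restrict_isSelfAdjoint _).star_eq] at this

lemma norm_truncated_le {θ : ℝ} {hθ : θ < 1} {h : InterlayerHopping} {b M : ℝ}
    (hM : ‖hamiltonian θ hθ h b‖ ≤ M) (L : ℝ) : ‖truncated θ hθ h b L‖ ≤ M := by
  have h1 := norm_restrict_le (box θ b L)
  calc ‖truncated θ hθ h b L‖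
      ≤ ‖restrict (box θ b L)‖ * ‖hamiltonian θ hθ h b‖ * ‖restrict (box θ b L)‖ :=
        (norm_mul_le _ _).trans (by gcongr; exact norm_mul_le _ _)
    _ ≤ 1 * M * 1 := by 
        have := (norm_nonneg _).trans hM
        gcongr
    _ = M := by ring

/-! ### The boundary error of a truncated power -/

/-- The trace is cyclic. -/
lemma sum_apply_restrict_comm (S : Finset Site) (A T : Space →L[ℂ] Space) :
    ∑ x ∈ S, A (restrict S (T (delta x))) x = ∑ y ∈ S, T (restrict S (A (delta y))) y := by
  simp only [restrict_eq_sum, map_sum, map_smul, lp.coeFn_sum, Finset.sum_apply, lp.coeFn_smul,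
    Pi.smul_apply, smul_eq_mul]
  rw [Finset.sum_comm]
  exact Finset.sum_congr rfl fun y _ => Finset.sum_congr rfl fun x _ => mul_comm _ _

variable {K : Site → Site → ℂ}

/-- The trace norm of the boundary term is bounded by the sum of its matrix elements. -/
lemma norm_sum_boundary_le (hK : IsSchurKernel K) {S : Finset Site} {τ : ℝ≥0}
    (hτ : ∑ y ∈ S, ∑' z, (if z ∈ S then 0 else ‖K y z‖ₑ) ≤ τ) {v : Site → Space} {c : ℝ}
    (hv : ∀ y, ‖v y‖ ≤ c) :
    ‖∑ y ∈ S, schurOp K hK (restrict S (v y) - v y) y‖ ≤ c * τ := by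
  have hc : 0 ≤ c := (norm_nonneg _).trans (hv (.inl 0))
  have key : ‖∑ y ∈ S, schurOp K hK (restrict S (v y) - v y) y‖ₑ ≤ ENNReal.ofReal c * τ := by
    calc ‖∑ y ∈ S, schurOp K hK (restrict S (v y) - v y) y‖ₑ
        ≤ ∑ y ∈ S, ‖schurOp K hK (restrict S (v y) - v y) y‖ₑ := enorm_sum_le _ _
      _ ≤ ∑ y ∈ S, ENNReal.ofReal c * ∑' z, (if z ∈ S then 0 else ‖K y z‖ₑ) := by
          refine Finset.sum_le_sum fun y _ => ?_
          rw [schurOp_apply, ← ENNReal.tsum_mul_left]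
          refine enorm_tsum_le_tsum_enorm.trans (ENNReal.tsum_le_tsum fun z => ?_)
          rw [enorm_mul, lp.coeFn_sub, Pi.sub_apply, restrict_apply]
          split_ifs
          · simp
          · rw [zero_sub, enorm_neg, mul_comm]
            gcongr
            rw [← ofReal_norm]
            exact ENNReal.ofReal_le_ofReal ((norm_coord_le _ _).trans (hv y))
      _ ≤ _ := by
          rw [← Finset.mul_sum]
          gcongr
  rw [← ofReal_norm, ← ENNReal.ofReal_coe_nnreal, ← ENNReal.ofReal_mul hc] at key
  exact (ENNReal.ofReal_le_ofReal_iff (by positivity)).1 key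

/-- Telescoping the power produces n boundary terms. The spectator A, eventually 1, is there for the
induction: it absorbs the factor P H P split off on the left. -/
lemma norm_sum_pow_sub_le (hK : IsSchurKernel K) {S : Finset Site} {τ : ℝ≥0}
    (hτ : ∑ y ∈ S, ∑' z, (if z ∈ S then 0 else ‖K y z‖ₑ) ≤ τ) {M : ℝ} (hM1 : 1 ≤ M)
    (hM : ‖schurOp K hK‖ ≤ M) (n : ℕ) (A : Space →L[ℂ] Space) :
    ‖∑ x ∈ S, A (((restrict S * schurOp K hK * restrict S) ^ n * restrict S -
      restrict S * schurOp K hK ^ n) (delta x)) x‖ ≤ n * ‖A‖ * M ^ n * τ := by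
  set P := restrict S with hP
  set H := schurOp K hK with hH
  have hPn : ‖P‖ ≤ 1 := norm_restrict_le S
  have hPP : P * P = P := restrict_mul_self S
  have hM0 : 0 ≤ M := zero_le_one.trans hM1
  have hKn : ‖P * H * P‖ ≤ M := by
    calc ‖P * H * P‖ ≤ ‖P‖ * ‖H‖ * ‖P‖ := (norm_mul_le _ _).trans (by gcongr; exact norm_mul_le _ _)
      _ ≤ 1 * M * 1 := by gcongr
      _ = M := by ring
  induction n generalizing A with
  | zero => simp
  | succ n ih =>
    have e : (P * H * P) ^ (n + 1) * P - P * H ^ (n + 1) =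
        (P * H * P) * ((P * H * P) ^ n * P - P * H ^ n) + P * (H * (P - 1) * H ^ n) := by
      have hPHP : P * H * P * (P * H ^ n) = P * H * P * H ^ n := by
        rw [mul_assoc (P * H) P, ← mul_assoc P P, hPP, mul_assoc (P * H)]
      rw [pow_succ', pow_succ', mul_sub, hPHP]
      noncomm_ring
    have e2 : ∀ x, A (((P * H * P) ^ (n + 1) * P - P * H ^ (n + 1)) (delta x)) x =
        (A * (P * H * P)) (((P * H * P) ^ n * P - P * H ^ n) (delta x)) x +
          A (P ((H * (P - 1) * H ^ n) (delta x))) x := by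
      intro x
      rw [e, add_apply, map_add, lp.coeFn_add, Pi.add_apply]
      rfl
    simp_rw [e2]
    rw [Finset.sum_add_distrib]
    have h1 := ih (A * (P * H * P))
    have h2 : ‖∑ x ∈ S, A (P ((H * (P - 1) * H ^ n) (delta x))) x‖ ≤ (M ^ n * ‖A‖) * τ := by
      -- Cyclicity moves A to the right, leaving coordinates in S of H applied to a vector supported
      -- off S; only kernel entries crossing the boundary remain.
      rw [hP, sum_apply_restrict_comm, ← hP]
      refine norm_sum_boundary_le hK hτ (v := fun y => (H ^ n) (P (A (delta y)))) fun y => ?_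
      calc ‖(H ^ n) (P (A (delta y)))‖ ≤ ‖H ^ n‖ * (‖P‖ * (‖A‖ * ‖delta y‖)) := by
            refine (ContinuousLinearMap.le_opNorm _ _).trans ?_
            gcongr
            refine (ContinuousLinearMap.le_opNorm _ _).trans ?_
            gcongr
            exact ContinuousLinearMap.le_opNorm _ _
        _ ≤ M ^ n * (1 * (‖A‖ * 1)) := by
            gcongr
            · exact (norm_pow_le H n).trans (by gcongr)
            · exact (norm_delta y).le
        _ = M ^ n * ‖A‖ := by ring
    calc _ ≤ n * ‖A * (P * H * P)‖ * M ^ n * τ + (M ^ n * ‖A‖) * τ :=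
          (norm_add_le _ _).trans (add_le_add h1 h2)
      _ ≤ n * (‖A‖ * M) * M ^ n * τ + (M ^ (n + 1) * ‖A‖) * τ := by
          gcongr
          · exact (norm_mul_le _ _).trans (by gcongr)
          · exact Nat.le_succ n
      _ = _ := by
          push_cast
          ring

/-- The hopping between the box and its complement is bounded uniformly in the size of the box. -/
lemma exists_boundary_le {θ : ℝ} (hθ0 : 0 < θ) (hθ : θ < 1) (h : InterlayerHopping) :
    ∃ τ : ℝ≥0, ∀ b L, ∑ y ∈ box θ b L, ∑' z,
      (if z ∈ box θ b L then 0 else ‖kernel θ h b y z‖ₑ) ≤ τ := by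
  obtain ⟨C, γ, hγ, hC⟩ := exists_kernel_le hθ0 hθ h
  obtain ⟨B, hB⟩ := exists_tsum_exp_position_le hθ hγ
  refine ⟨C.toNNReal * (B * B + B * B), fun b L => ?_⟩
  let w : ℝ → Site → ℝ≥0∞ := fun t y => ENNReal.ofReal (Real.exp (-γ * |t - position θ b y|))
  have hw : ∀ t, ∑' y, w t y ≤ B := hB b
  have hw' : ∀ t, ∑ y ∈ box θ b L, w t y ≤ B := fun t => (ENNReal.sum_le_tsum _).trans (hw t)
  -- A hop from y inside to z outside passes an endpoint ±L. Distances add there, so the exponential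
  -- factorizes and the double sum is at most B * B per endpoint.
  have hsplit : ∀ y ∈ box θ b L, ∀ z, (if z ∈ box θ b L then 0 else ‖kernel θ h b y z‖ₑ) ≤
      ENNReal.ofReal C * (w L y * w L z + w (-L) y * w (-L) z) := by
    intro y hy z
    split_ifs with hz
    · exact zero_le
    refine (enorm_kernel_le hC b y z).trans ?_
    gcongr
    rw [mem_box_iff hθ] at hy hz
    simp only [w]
    rw [← ENNReal.ofReal_mul (Real.exp_pos _).le, ← ENNReal.ofReal_mul (Real.exp_pos _).le,
      ← Real.exp_add, ← Real.exp_add]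
    rcases lt_or_ge L (position θ b z) with hL | hL
    · refine le_trans (ENNReal.ofReal_le_ofReal (Real.exp_le_exp.2 (le_of_eq ?_))) le_self_add
      rw [abs_of_nonneg (sub_nonneg.2 hy.2),
        abs_of_nonpos (by linarith : L - position θ b z ≤ 0),
        abs_of_nonpos (by linarith [hy.2] : position θ b y - position θ b z ≤ 0)]
      ring
    · have hL' : position θ b z < -L := lt_of_not_ge fun h' => hz ⟨h', hL⟩
      refine le_trans (ENNReal.ofReal_le_ofReal (Real.exp_le_exp.2 (le_of_eq ?_))) le_add_self
      rw [abs_of_nonpos (by linarith [hy.1] : -L - position θ b y ≤ 0),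
        abs_of_nonneg (by linarith : 0 ≤ -L - position θ b z),
        abs_of_nonneg (by linarith [hy.1] : 0 ≤ position θ b y - position θ b z)]
      ring
  calc ∑ y ∈ box θ b L, ∑' z, (if z ∈ box θ b L then 0 else ‖kernel θ h b y z‖ₑ)
      ≤ ∑ y ∈ box θ b L, ENNReal.ofReal C * (w L y * B + w (-L) y * B) := by
        refine Finset.sum_le_sum fun y hy => (ENNReal.tsum_le_tsum (hsplit y hy)).trans ?_
        rw [ENNReal.tsum_mul_left, ENNReal.tsum_add, ENNReal.tsum_mul_left, ENNReal.tsum_mul_left]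
        gcongr <;> exact hw _
    _ ≤ _ := by
        rw [← Finset.mul_sum, Finset.sum_add_distrib, ← Finset.sum_mul, ← Finset.sum_mul]
        push_cast
        gcongr
        · exact le_rfl
        · exact hw' _
        · exact hw' _

/-! ### Observables of the Hamiltonian as functions of the shift -/

lemma diag_pow {A : Space →L[ℂ] Space} (hA : IsSelfAdjoint A) (n : ℕ) (x : Site) :
    diag (fun t => (t : ℂ) ^ n) A x = (A ^ n) (delta x) x := by
  rw [diag_eq, opFun_pow hA]

lemma exists_isState_diag_hamiltonian {θ : ℝ} (hθ0 : 0 < θ) (hθ : θ < 1) (h : InterlayerHopping) :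
    ∃ M : ℝ, 1 ≤ M ∧ (∀ b, ‖hamiltonian θ hθ h b‖ ≤ M) ∧
      ∀ b x, IsState M fun g => diag g (hamiltonian θ hθ h b) x := by
  obtain ⟨M, hM1, hM⟩ := exists_norm_hamiltonian_le hθ0 hθ h
  exact ⟨M, hM1, hM, fun b x => isState_diag (hamiltonian_isSelfAdjoint θ hθ h b) (hM b) x⟩

/-- The spectral functionals at all shifts are states with a common M, so continuity of the moments
in b is enough. -/
lemma continuous_diag_hamiltonian {θ : ℝ} (hθ0 : 0 < θ) (hθ : θ < 1) (h : InterlayerHopping)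
    {g : ℝ → ℂ} (hg : Continuous g) (x : Site) :
    Continuous fun b => diag g (hamiltonian θ hθ h b) x := by
  obtain ⟨M, -, -, hI⟩ := exists_isState_diag_hamiltonian hθ0 hθ h
  refine continuous_iff_continuousAt.2 fun c =>
    IsState.tendsto_of_pow (fun b => hI b x) (hI c x) (fun n => ?_) hg
  simp_rw [diag_pow (hamiltonian_isSelfAdjoint θ hθ h _)]
  exact (continuous_pow_hamiltonian hθ0 hθ h n x x).tendsto c

lemma diag_hamiltonian_shift {θ : ℝ} (hθ0 : 0 < θ) (hθ : θ < 1) (h : InterlayerHopping)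
    {g : ℝ → ℂ} (hg : Continuous g) (b : ℝ) (n m : ℤ) (x : Site) :
    diag g (hamiltonian θ hθ h b) (shift n m x) =
      diag g (hamiltonian θ hθ h (b - n + (1 - θ) * m)) x := by
  obtain ⟨M, -, -, hI⟩ := exists_isState_diag_hamiltonian hθ0 hθ h
  -- Two states with equal moments agree on continuous functions: `IsState.tendsto_of_pow` for a
  -- constant family over `Unit`.
  refine tendsto_const_nhds_iff.1 (IsState.tendsto_of_pow (l := (⊤ : Filter Unit))
    (fun _ => hI b (shift n m x)) (hI _ x) (fun k => ?_) hg)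
  simp_rw [diag_pow (hamiltonian_isSelfAdjoint θ hθ h _)]
  exact tendsto_const_nhds_iff.2
    (pow_hamiltonian_of_kernel_eq hθ h (shift n m) (kernel_shift θ h b n m) k x x)

lemma diag_hamiltonian_inl {θ : ℝ} (hθ0 : 0 < θ) (hθ : θ < 1) (h : InterlayerHopping)
    {g : ℝ → ℂ} (hg : Continuous g) (b : ℝ) (n : ℤ) :
    diag g (hamiltonian θ hθ h b) (.inl n) =
      diag g (hamiltonian θ hθ h (b + n * (-1))) (.inl 0) := by
  have := diag_hamiltonian_shift hθ0 hθ h hg b n 0 (.inl 0)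
  simp only [shift, Equiv.sumCongr_apply, Sum.map_inl, Equiv.coe_addRight, zero_add] at this
  rw [this]
  congr 2
  simp [sub_eq_add_neg]

lemma diag_hamiltonian_inr {θ : ℝ} (hθ0 : 0 < θ) (hθ : θ < 1) (h : InterlayerHopping)
    {g : ℝ → ℂ} (hg : Continuous g) (b : ℝ) (n : ℤ) :
    diag g (hamiltonian θ hθ h b) (.inr n) =
      diag g (hamiltonian θ hθ h (b + n * (1 - θ))) (.inr 0) := by
  have := diag_hamiltonian_shift hθ0 hθ h hg b 0 n (.inr 0)
  simp only [shift, Equiv.sumCongr_apply, Sum.map_inr, Equiv.coe_addRight, zero_add] at this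
  rw [this]
  congr 2
  simp [mul_comm]

/-- Moving chain 2 by one site fixes the origin of chain 1 and changes the shift by 1 - θ. -/
lemma periodic_diag_inl {θ : ℝ} (hθ0 : 0 < θ) (hθ : θ < 1) (h : InterlayerHopping)
    {g : ℝ → ℂ} (hg : Continuous g) :
    Function.Periodic (fun b => diag g (hamiltonian θ hθ h b) (.inl 0)) (1 - θ) := by
  intro b
  have := diag_hamiltonian_shift hθ0 hθ h hg b 0 1 (.inl 0)
  simp only [shift, Equiv.sumCongr_apply, Sum.map_inl, Equiv.coe_addRight, zero_add] at this
  simp only [this]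
  congr 2
  simp

lemma periodic_diag_inr {θ : ℝ} (hθ0 : 0 < θ) (hθ : θ < 1) (h : InterlayerHopping)
    {g : ℝ → ℂ} (hg : Continuous g) :
    Function.Periodic (fun b => diag g (hamiltonian θ hθ h b) (.inr 0)) 1 := by
  intro b
  have := diag_hamiltonian_shift hθ0 hθ h hg b (-1) 0 (.inr 0)
  simp only [shift, Equiv.sumCongr_apply, Sum.map_inr, Equiv.coe_addRight, zero_add] at this
  simp only [this]
  congr 2
  simp

lemma integrableOn_diag_hamiltonian {θ : ℝ} (hθ0 : 0 < θ) (hθ : θ < 1) (h : InterlayerHopping)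
    {g : ℝ → ℂ} (hg : Continuous g) (x : Site) (s t : ℝ) :
    IntegrableOn (fun b => diag g (hamiltonian θ hθ h b) x) (Set.Ico s t) :=
  ((continuous_diag_hamiltonian hθ0 hθ h hg x).continuousOn.integrableOn_Icc).mono_set
    Set.Ico_subset_Icc_self

/-! ### The functionals are states -/

lemma IsState.setAverage {M T : ℝ} (hT : 0 < T) {I : ℝ → (ℝ → ℂ) → ℂ} (hI : ∀ b, IsState M (I b))
    (hint : ∀ g, Continuous g → IntegrableOn (fun b => I b g) (Set.Ico 0 T)) :
    IsState M fun g => ((1 / T : ℝ) : ℂ) * ∫ b in Set.Ico 0 T, I b g := by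
  have hT' : (T : ℂ) ≠ 0 := by exact_mod_cast hT.ne'
  refine ⟨fun f g hf hg => ?_, fun c f hf => ?_, ?_, fun f hf h0 => ?_, fun f c hf hc =>
    norm_setAverage_le hT fun b => (hI b).norm_le f c hf hc⟩
  · simp_rw [(hI _).map_add f g hf hg]
    rw [integral_add (hint f hf) (hint g hg), mul_add]
  · simp_rw [(hI _).map_mul c f hf]
    rw [integral_const_mul, mul_left_comm]
  · simp_rw [(hI _).map_one]
    rw [setIntegral_const]
    simp [hT.le, hT']
  · refine mul_nonneg (Complex.zero_le_real.2 (by positivity)) ?_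
    -- The integrand is real-valued, so positivity reduces to that of a real integral.
    have e : (fun b => I b fun x => (f x : ℂ)) = fun b => (((I b fun x => (f x : ℂ)).re : ℝ) : ℂ) :=
      funext fun b => ((hI b).ofReal_re hf).symm
    rw [e, integral_complex_ofReal]
    exact Complex.zero_le_real.2
      (integral_nonneg fun b => (Complex.le_def.1 ((hI b).nonneg f hf h0)).1)

lemma IsState.convex {M s t : ℝ} (hs : 0 ≤ s) (ht : 0 ≤ t) (hst : s + t = 1)
    {I J : (ℝ → ℂ) → ℂ} (hI : IsState M I) (hJ : IsState M J) :
    IsState M fun g => s * I g + t * J g := by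
  have hst' : (s : ℂ) + t = 1 := by exact_mod_cast hst
  refine ⟨fun f g hf hg => ?_, fun c f hf => ?_, ?_, fun f hf h0 => ?_, fun f c hf hc => ?_⟩
  · simp only [hI.map_add f g hf hg, hJ.map_add f g hf hg]
    ring
  · simp only [hI.map_mul c f hf, hJ.map_mul c f hf]
    ring
  · simp only [hI.map_one, hJ.map_one, mul_one, hst']
  · exact add_nonneg (mul_nonneg (Complex.zero_le_real.2 hs) (hI.nonneg f hf h0))
      (mul_nonneg (Complex.zero_le_real.2 ht) (hJ.nonneg f hf h0))
  · refine (norm_add_le _ _).trans ?_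
    rw [norm_mul, norm_mul, Complex.norm_real, Complex.norm_real, Real.norm_of_nonneg hs,
      Real.norm_of_nonneg ht]
    calc s * ‖I f‖ + t * ‖J f‖ ≤ s * c + t * c := by
          gcongr
          · exact hI.norm_le f c hf hc
          · exact hJ.norm_le f c hf hc
      _ = c := by rw [← add_mul, hst, one_mul]

lemma isState_limitFunctional {θ : ℝ} (hθ0 : 0 < θ) (hθ : θ < 1) {h : InterlayerHopping} {M : ℝ}
    (hI : ∀ b x, IsState M fun g => diag g (hamiltonian θ hθ h b) x) :
    IsState M (limitFunctional θ hθ h) := by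
  have h1 : 0 < 1 - θ := by linarith
  have hs := IsState.convex (s := (1 - θ) / (1 + (1 - θ))) (t := 1 / (1 + (1 - θ)))
    (by positivity) (by positivity) (by field_simp; ring)
    (IsState.setAverage h1 (fun b => hI b (.inl 0))
      fun g hg => integrableOn_diag_hamiltonian hθ0 hθ h hg _ _ _)
    (IsState.setAverage one_pos (fun b => hI b (.inr 0))
      fun g hg => integrableOn_diag_hamiltonian hθ0 hθ h hg _ _ _)
  refine (congrArg (IsState M) (funext fun g => ?_)).mpr hs
  simp [limitFunctional]

lemma isState_normalizedTrace {θ : ℝ} {hθ : θ < 1} {h : InterlayerHopping} {M : ℝ}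
    (hM : ∀ b, ‖hamiltonian θ hθ h b‖ ≤ M) (b : ℝ) {L : ℝ} (hL : 0 < L) :
    IsState M (normalizedTrace θ hθ h b L) :=
  -- The origin of chain 1 always lies in the box; for small L the part in chain 2 may be empty.
  IsState.average ⟨.inl 0, (inl_mem_box θ b L 0).2 (by simp [hL.le])⟩
    fun x => isState_diag (truncated_isSelfAdjoint θ hθ h b L) (norm_truncated_le (hM b) L) x

/-! ### The thermodynamic limit -/

lemma card_Icc_ceil_floor_bounds {p q : ℝ} (hpq : p ≤ q) :
    q - p - 1 ≤ ((Finset.Icc ⌈p⌉ ⌊q⌋).card : ℝ) ∧ ((Finset.Icc ⌈p⌉ ⌊q⌋).card : ℝ) ≤ q - p + 1 := by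
  have h1 := Int.floor_le q
  have h2 := Int.lt_floor_add_one q
  have h3 := Int.le_ceil p
  have h4 := Int.ceil_lt_add_one p
  -- Guards against truncation by `toNat` in the cardinality formula.
  have h5 : (0 : ℤ) ≤ ⌊q⌋ + 1 - ⌈p⌉ := by
    have : (-1 : ℝ) < ((⌊q⌋ + 1 - ⌈p⌉ : ℤ) : ℝ) := by
      push_cast
      linarith
    have : (-1 : ℤ) < ⌊q⌋ + 1 - ⌈p⌉ := by exact_mod_cast this
    omega
  have e : ((Finset.Icc ⌈p⌉ ⌊q⌋).card : ℝ) = ⌊q⌋ + 1 - ⌈p⌉ := by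
    rw [Int.card_Icc]
    have := Int.toNat_of_nonneg h5
    have h6 : (((⌊q⌋ + 1 - ⌈p⌉).toNat : ℤ) : ℝ) = ((⌊q⌋ + 1 - ⌈p⌉ : ℤ) : ℝ) := by rw [this]
    push_cast at h6
    exact h6
  rw [e]
  constructor <;> linarith

/-- The interval has length 2 L / a whatever the offset s, and rounding changes the count by at most
1. -/
lemma tendsto_card_Icc_div {a : ℝ} (ha : 0 < a) (s : ℝ) :
    Tendsto (fun L : ℝ => ((Finset.Icc ⌈-((L + s) / a)⌉ ⌊(L - s) / a⌋).card : ℝ) / L) atTop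
      (𝓝 (2 / a)) := by
  have hinv : Tendsto (fun L : ℝ => L⁻¹) atTop (𝓝 0) := tendsto_inv_atTop_zero
  have hlow : Tendsto (fun L : ℝ => 2 / a - L⁻¹) atTop (𝓝 (2 / a)) := by
    simpa using hinv.const_sub (2 / a)
  have hup : Tendsto (fun L : ℝ => 2 / a + L⁻¹) atTop (𝓝 (2 / a)) := by
    simpa using hinv.const_add (2 / a)
  have key : ∀ L : ℝ, 0 < L →
      2 / a - L⁻¹ ≤ ((Finset.Icc ⌈-((L + s) / a)⌉ ⌊(L - s) / a⌋).card : ℝ) / L ∧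
        ((Finset.Icc ⌈-((L + s) / a)⌉ ⌊(L - s) / a⌋).card : ℝ) / L ≤ 2 / a + L⁻¹ := by
    intro L hL
    have e : (L - s) / a - -((L + s) / a) = 2 / a * L := by ring
    have hpq : -((L + s) / a) ≤ (L - s) / a := by
      rw [← sub_nonneg, e]
      positivity
    obtain ⟨h1, h2⟩ := card_Icc_ceil_floor_bounds hpq
    rw [e] at h1 h2
    rw [le_div_iff₀ hL, div_le_iff₀ hL, sub_mul, add_mul, inv_mul_cancel₀ hL.ne']
    exact ⟨h1, h2⟩
  refine tendsto_of_tendsto_of_tendsto_of_le_of_le' hlow hup ?_ ?_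
  · filter_upwards [eventually_gt_atTop 0] with L hL using (key L hL).1
  · filter_upwards [eventually_gt_atTop 0] with L hL using (key L hL).2

/-- The average over the box of a diagonal observable of the full Hamiltonian converges. -/
lemma tendsto_average_diag_hamiltonian {θ : ℝ} (hθ0 : 0 < θ) (hθ : θ < 1) (hirr : Irrational θ)
    (h : InterlayerHopping) (b : ℝ) {g : ℝ → ℂ} (hg : Continuous g) :
    Tendsto (fun L => ((box θ b L).card : ℂ)⁻¹ *
      ∑ x ∈ box θ b L, diag g (hamiltonian θ hθ h b) x) atTop (𝓝 (limitFunctional θ hθ h g)) := by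
  have h1 : 0 < 1 - θ := by linarith
  have hc₁ : Tendsto (fun L : ℝ => ((Finset.Icc ⌈-L⌉ ⌊L⌋).card : ℝ) / L) atTop (𝓝 2) := by
    simpa using tendsto_card_Icc_div one_pos 0
  have hc₂ := tendsto_card_Icc_div h1 b
  have hatTop : ∀ {c : ℝ → ℕ} {r : ℝ}, 0 < r →
      Tendsto (fun L : ℝ => (c L : ℝ) / L) atTop (𝓝 r) →
        Tendsto (fun L : ℝ => (c L : ℝ)) atTop atTop := by
    intro c r hr hc
    refine (hc.pos_mul_atTop hr tendsto_id).congr' ?_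
    filter_upwards [eventually_gt_atTop 0] with L hL
    exact div_mul_cancel₀ _ hL.ne'
  have hw : ∀ {c d : ℝ → ℕ} {r s : ℝ}, 0 < r → 0 < s →
      Tendsto (fun L : ℝ => (c L : ℝ) / L) atTop (𝓝 r) →
      Tendsto (fun L : ℝ => (d L : ℝ) / L) atTop (𝓝 s) →
        Tendsto (fun L : ℝ => (((c L : ℝ) / ((c L : ℝ) + d L) : ℝ) : ℂ)) atTop
          (𝓝 ((r / (r + s) : ℝ) : ℂ)) := by
    intro c d r s hr hs hc hd
    refine (Complex.continuous_ofReal.tendsto _).comp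
      ((hc.div (hc.add hd) (by positivity)).congr' ?_)
    filter_upwards [eventually_gt_atTop 0] with L hL
    rw [Pi.div_apply, ← add_div, div_div_div_cancel_right₀ hL.ne']
  -- Along chain 1 the shift moves by -1 on a circle of length 1 - θ, a rotation by the irrational
  -- number -1 / (1 - θ).
  have ha₁ := tendsto_average_of_periodic (α := -1) h1
    (by
      rw [neg_div, irrational_neg_iff, one_div, irrational_inv_iff]
      simpa using hirr.ratCast_sub 1)
    (continuous_diag_hamiltonian hθ0 hθ h hg (.inl 0)) (periodic_diag_inl hθ0 hθ h hg) b
    (hatTop two_pos hc₁)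
  have ha₂ := tendsto_average_of_periodic (α := 1 - θ) one_pos
    (by
      rw [div_one]
      simpa using hirr.ratCast_sub 1)
    (continuous_diag_hamiltonian hθ0 hθ h hg (.inr 0)) (periodic_diag_inr hθ0 hθ h hg) b
    (hatTop (by positivity) hc₂)
  have hw₁ := hw two_pos (by positivity) hc₁ hc₂
  have hw₂ := hw (by positivity) two_pos hc₂ hc₁
  have hlim := (hw₁.mul ha₁).add (hw₂.mul ha₂)
  -- Per unit of L there are asymptotically 2 sites on chain 1 and 2 / (1 - θ) on chain 2; the
  -- weights are these proportions.
  have e₁ : (2 / (2 + 2 / (1 - θ)) : ℝ) = (1 - θ) / (1 + (1 - θ)) := by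
    field_simp
    ring
  have e₂ : (2 / (1 - θ) / (2 / (1 - θ) + 2) : ℝ) = 1 / (1 + (1 - θ)) := by
    field_simp
  rw [e₁, e₂, div_one (1 : ℝ), Complex.ofReal_one, one_mul] at hlim
  refine hlim.congr' ?_
  filter_upwards [(hatTop two_pos hc₁).eventually_gt_atTop 0,
    (hatTop (by positivity) hc₂).eventually_gt_atTop 0] with L hL₁ hL₂
  simp_rw [← diag_hamiltonian_inl hθ0 hθ h hg b, ← diag_hamiltonian_inr hθ0 hθ h hg b]
  rw [box, Finset.card_disjSum, Finset.sum_disjSum]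
  set c := (Finset.Icc ⌈-L⌉ ⌊L⌋).card
  set d := (Finset.Icc ⌈-((L + b) / (1 - θ))⌉ ⌊(L - b) / (1 - θ)⌋).card
  have k₁ : (c : ℂ) ≠ 0 := by
    have := hL₁.ne'
    exact_mod_cast this
  have k₂ : (d : ℂ) ≠ 0 := by
    have := hL₂.ne'
    exact_mod_cast this
  have k₃ : (c : ℂ) + d ≠ 0 := by
    have := (add_pos hL₁ hL₂).ne'
    exact_mod_cast this
  push_cast
  field_simp
  ring

lemma tendsto_card_box {θ : ℝ} (hθ : θ < 1) (b : ℝ) :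
    Tendsto (fun L => ((box θ b L).card : ℝ)) atTop atTop := by
  have h1 : 0 < 1 - θ := by linarith
  have hc := (tendsto_card_Icc_div h1 b).pos_mul_atTop (by positivity) tendsto_id
  refine tendsto_atTop_mono' _ ?_ hc
  filter_upwards [eventually_gt_atTop 0] with L hL
  rw [id, div_mul_cancel₀ _ hL.ne', box, Finset.card_disjSum]
  push_cast
  linarith [Nat.cast_nonneg (α := ℝ) (Finset.Icc ⌈-L⌉ ⌊L⌋).card]

/-- The normalized traces of the truncated Hamiltonians converge, for every shift. -/
theorem tendsto_normalizedTrace {θ : ℝ} (hθ0 : 0 < θ) (hθ : θ < 1) (hirr : Irrational θ)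
    (h : InterlayerHopping) (b : ℝ) {g : ℝ → ℂ} (hg : Continuous g) :
    Tendsto (fun L => normalizedTrace θ hθ h b L g) atTop (𝓝 (limitFunctional θ hθ h g)) := by
  obtain ⟨M, hM1, hM, hI⟩ := exists_isState_diag_hamiltonian hθ0 hθ h
  obtain ⟨τ, hτ⟩ := exists_boundary_le hθ0 hθ h
  -- For L < 0 the box is empty and the normalized trace is not a state, so L is restricted to the
  -- positive reals.
  suffices hsub : Tendsto (fun L : Set.Ioi (0 : ℝ) => normalizedTrace θ hθ h b L g)
      (comap ((↑) : Set.Ioi (0 : ℝ) → ℝ) atTop) (𝓝 (limitFunctional θ hθ h g)) by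
    refine (tendsto_comap'_iff (i := ((↑) : Set.Ioi (0 : ℝ) → ℝ)) ?_).1 hsub
    rw [Subtype.range_coe]
    exact Ioi_mem_atTop 0
  refine IsState.tendsto_of_pow (I := fun L : Set.Ioi (0 : ℝ) => normalizedTrace θ hθ h b L)
    (fun L => isState_normalizedTrace hM b L.2) (isState_limitFunctional hθ0 hθ hI)
    (fun n => ?_) hg
  refine Tendsto.comp (f := ((↑) : Set.Ioi (0 : ℝ) → ℝ))
    (g := fun L => normalizedTrace θ hθ h b L fun x : ℝ => (x : ℂ) ^ n) ?_ tendsto_comap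
  have hfull := tendsto_average_diag_hamiltonian hθ0 hθ hirr h b
    (g := fun x : ℝ => (x : ℂ) ^ n) (by fun_prop)
  have hdiff : Tendsto (fun L => (normalizedTrace θ hθ h b L fun x : ℝ => (x : ℂ) ^ n) -
      ((box θ b L).card : ℂ)⁻¹ *
        ∑ x ∈ box θ b L, diag (fun x : ℝ => (x : ℂ) ^ n) (hamiltonian θ hθ h b) x) atTop (𝓝 0) := by
    refine squeeze_zero_norm (a := fun L => ((box θ b L).card : ℝ)⁻¹ * (n * 1 * M ^ n * τ))
      (fun L => ?_) (by simpa using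
        (tendsto_inv_atTop_zero.comp (tendsto_card_box hθ b)).mul_const (n * 1 * M ^ n * τ : ℝ))
    have hb := norm_sum_pow_sub_le (kernel_isSchurKernel hθ h b) (hτ b L) hM1 (hM b) n 1
    rw [norm_one] at hb
    rw [normalizedTrace, ← mul_sub, ← Finset.sum_sub_distrib, norm_mul, norm_inv,
      Complex.norm_natCast]
    gcongr
    refine le_of_eq_of_le (congrArg _ (Finset.sum_congr rfl fun x hx => ?_)) hb
    rw [diag_pow (truncated_isSelfAdjoint θ hθ h b L),
      diag_pow (hamiltonian_isSelfAdjoint θ hθ h b)]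
    change _ = ((truncated θ hθ h b L ^ n) (restrict (box θ b L) (delta x)) -
      restrict (box θ b L) ((hamiltonian θ hθ h b ^ n) (delta x))) x
    -- At a site x of the box the projections on either side are invisible to the diagonal element.
    rw [restrict_delta hx, lp.coeFn_sub, Pi.sub_apply, restrict_apply, if_pos hx]
  simpa using hdiff.add hfull

end CoupledChain

end

/-! ### The main theorem -/

theorem mainTheorem1 (θ : ℝ) (hθ0 : 0 < θ) (hθ1 : θ < 1) (hirr : Irrational θ)
    (h : CoupledChain.InterlayerHopping) :
    -- the two averaged observables are integrable over the unit cells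
    (∀ g : C₀(ℝ, ℂ),
      IntegrableOn (fun b => CoupledChain.diag g (CoupledChain.hamiltonian θ hθ1 h b) (.inl 0))
        (Set.Ico 0 (1 - θ)) ∧
      IntegrableOn (fun b => CoupledChain.diag g (CoupledChain.hamiltonian θ hθ1 h b) (.inr 0))
        (Set.Ico 0 1)) ∧
    -- the density of states measures `dk` and `dk_{b,L}`
    ∃ (k : Measure ℝ) (kL : ℝ → ℝ → Measure ℝ),
      (CoupledChain.IsRadonMeasureOf (CoupledChain.limitFunctional θ hθ1 h) k ∧
        IsProbabilityMeasure k) ∧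
      (∀ b L : ℝ, 0 < L →
        CoupledChain.IsRadonMeasureOf (CoupledChain.normalizedTrace θ hθ1 h b L) (kL b L) ∧
          IsProbabilityMeasure (kL b L)) ∧
      ∀ᵐ b : ℝ, ∀ ε : ℝ → ℝ, Tendsto ε atTop (𝓝 0) →
        (∀ L : ℝ, 0 < L →
          CoupledChain.IsTraceClass (CoupledChain.truncated θ hθ1 h b L -
            CoupledChain.restrict (CoupledChain.box θ b L) *
              CoupledChain.hamiltonian θ hθ1 h b) ∧
          CoupledChain.traceAbs (CoupledChain.truncated θ hθ1 h b L -
            CoupledChain.restrict (CoupledChain.box θ b L) *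
              CoupledChain.hamiltonian θ hθ1 h b) ≤
            ε L * ((CoupledChain.box θ b L).card : ℝ)) →
        (∀ g : C₀(ℝ, ℂ),
          Tendsto (fun L : ℝ => CoupledChain.normalizedTrace θ hθ1 h b L g) atTop
            (𝓝 (CoupledChain.limitFunctional θ hθ1 h g))) ∧
        (∀ g : ℝ →ᵇ ℂ,
          Tendsto (fun L : ℝ => ∫ x, g x ∂(kL b L)) atTop (𝓝 (∫ x, g x ∂k))) := by
  classical
  obtain ⟨M, -, hM, hI⟩ := CoupledChain.exists_isState_diag_hamiltonian hθ0 hθ1 h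
  have hk := CoupledChain.isState_limitFunctional hθ0 hθ1 hI
  have hkL := fun b (L : ℝ) (hL : 0 < L) => CoupledChain.isState_normalizedTrace hM b hL
  refine ⟨fun g =>
    ⟨CoupledChain.integrableOn_diag_hamiltonian hθ0 hθ1 h g.continuous _ _ _,
      CoupledChain.integrableOn_diag_hamiltonian hθ0 hθ1 h g.continuous _ _ _⟩,
    hk.measure, fun b L => if hL : 0 < L then (hkL b L hL).measure else 0,
    ⟨hk.isRadonMeasureOf, inferInstance⟩, fun b L hL => ?_,
    Eventually.of_forall fun b ε _ _ => ⟨fun g =>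
      CoupledChain.tendsto_normalizedTrace hθ0 hθ1 hirr h b g.continuous, fun g => ?_⟩⟩
  · simp only [dif_pos hL]
    exact ⟨(hkL b L hL).isRadonMeasureOf, inferInstance⟩
  -- The measures represent their functionals on all continuous functions, so no separate tightness
  -- argument is needed.
  · rw [hk.integral_eq g.continuous]
    refine (CoupledChain.tendsto_normalizedTrace hθ0 hθ1 hirr h b g.continuous).congr' ?_
    filter_upwards [eventually_gt_atTop 0] with L hL
    rw [dif_pos hL, (hkL b L hL).integral_eq g.continuous]
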